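/- Let $\alpha,a,b,d_1,d_2\in\mathbb R$ and $\omega>0$ with $\beta:=-\tfrac{16}{3}\alpha\omega<1$. Let $R_0>0$ be given by $R_0^2(z)=\dfrac{4\omega}{1+\sqrt{1-\beta}\,\cosh(2\sqrt\omega\,z)}$, let $S_0=R_0'/R_0$, and set $\Lambda_m=\int_{\mathbb R}R_0^m(z)\,dz$ and $\Lambda_2'=\int_{\mathbb R}(R_0'(z))^2\,dz$. For $\epsilon\in\mathbb R$ let $\Delta=1+\epsilon^2a^2$ and consider the steady-state system (at wave speed $c=0$) $$r'=rs,$$ $$\Delta s'=-\Delta s^2+\Delta\phi^2-(-\omega+\epsilon^2ab)-(1+\epsilon^2ad_1)r^2-(\alpha+\epsilon^2ad_2)r^4,$$ $$\Delta\phi'=-2\Delta s\phi-\epsilon\big[(b+a\omega)+(d_1-a)r^2+(d_2-a\alpha)r^4\big].$$ Let $(r^u,s^u,\phi^u)(z)=(r^u,s^u,\phi^u)(z;\epsilon)$, $z\le 0$, be the trajectory with $r^u>0$ in the unstable manifold of the rest point with $r=0$, $s>0$ (that is, the solution with $r^u>0$ tending to that rest point as $z\to-\infty$), with the translation in $z$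 fixed so that $s^u(0)=0$ and $s^u(z)>0$ for $z<0$. Then for all sufficiently small $|\epsilon|$ this trajectory exists and is unique, and for $\epsilon=0$ it is $(R_0,S_0,0)$. The integrals $\Lambda_2,\Lambda_4,\Lambda_6,\Lambda_2'$ converge. Moreover, $\epsilon\mapsto\phi^u(0;\epsilon)$ is differentiable at $\epsilon=0$ and, with $\phi_\epsilon(z):=\partial_\epsilon\phi^u(z;\epsilon)|_{\epsilon=0}$, $$\phi^u(0;\epsilon)=\epsilon\,\phi_\epsilon(0)+O(\epsilon^2)\quad(\epsilon\to0),\qquad 2R_0^2(0)\,\phi_\epsilon(0)=\Lambda_2'\,a-\Lambda_2\,b-\Lambda_4\,d_1-\Lambda_6\,d_2 .$$ -/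

import Mathlib

open Filter Topology Asymptotics MeasureTheory

noncomputable section

namespace PCQNLS

/-- The real parameters `α, a, b, d₁, d₂` of the perturbed cubic-quintic equation, and the
wave parameter `ω`. -/
structure Params where
  α : ℝ
  a : ℝ
  b : ℝ
  d₁ : ℝ
  d₂ : ℝ
  ω : ℝ

namespace Params

/-- `β = -(16/3) α ω`. -/
def β (P : Params) : ℝ := -(16 / 3) * P.α * P.ω

/-- The unperturbed wave profile: the positive function `R₀` with
`R₀² = 4ω / (1 + √(1-β) cosh (2√ω z))`. -/
def R₀ (P : Params) (z : ℝ) : ℝ :=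
  √(4 * P.ω / (1 + √(1 - P.β) * Real.cosh (2 * √P.ω * z)))

/-- `S₀ = R₀' / R₀`. -/
def S₀ (P : Params) (z : ℝ) : ℝ := deriv P.R₀ z / P.R₀ z

/-- `Λ_m = ∫_ℝ R₀^m`. -/
def Λ (P : Params) (m : ℕ) : ℝ := ∫ z : ℝ, P.R₀ z ^ m

/-- `Λ₂' = ∫_ℝ (R₀')²`. -/
def Λ₂' (P : Params) : ℝ := ∫ z : ℝ, deriv P.R₀ z ^ 2

/-- `Δ = 1 + ε² a²`. -/
def Δ (P : Params) (ε : ℝ) : ℝ := 1 + ε ^ 2 * P.a ^ 2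

/-- The `s`-component of the vector field of the steady-state system (wave speed `c`). -/
def fs (P : Params) (c ε r s φ : ℝ) : ℝ :=
  (-P.Δ ε * s ^ 2 + P.Δ ε * φ ^ 2 - c * (ε * P.a * s - φ) - (-P.ω + ε ^ 2 * P.a * P.b)
    - (1 + ε ^ 2 * P.a * P.d₁) * r ^ 2 - (P.α + ε ^ 2 * P.a * P.d₂) * r ^ 4) / P.Δ ε

/-- The `φ`-component of the vector field of the steady-state system (wave speed `c`). -/
def fφ (P : Params) (c ε r s φ : ℝ) : ℝ :=
  (-2 * P.Δ ε * s * φ - c * (s + ε * P.a * φ)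
    - ε * ((P.b + P.a * P.ω) + (P.d₁ - P.a) * r ^ 2 + (P.d₂ - P.a * P.α) * r ^ 4)) / P.Δ ε

/-- `(r, s, φ)`, restricted to `(-∞, 0]`, solves the steady-state system
`r' = r s`, `s' = fs`, `φ' = fφ` (one-sided derivatives at `z = 0`). -/
structure IsSolution (P : Params) (c ε : ℝ) (r s φ : ℝ → ℝ) : Prop where
  hr : ∀ z ≤ 0, HasDerivWithinAt r (r z * s z) (Set.Iic 0) z
  hs : ∀ z ≤ 0, HasDerivWithinAt s (P.fs c ε (r z) (s z) (φ z)) (Set.Iic 0) z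
  hφ : ∀ z ≤ 0, HasDerivWithinAt φ (P.fφ c ε (r z) (s z) (φ z)) (Set.Iic 0) z

/-- `(0, s, φ)` is the rest point of the steady-state system with `r = 0` and `s > 0`; its
unstable manifold is one-dimensional (for small `c` and `ε`). -/
structure IsRestPoint (P : Params) (c ε s φ : ℝ) : Prop where
  pos : 0 < s
  fs_eq : P.fs c ε 0 s φ = 0
  fφ_eq : P.fφ c ε 0 s φ = 0

/-- `(r, s, φ)` is the trajectory `W^u_p` in the part `r > 0` of the unstable manifold of the
rest point, on `(-∞, 0]`: a solution that tends to the rest point as `z → -∞`, with the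
translation in `z` fixed so that `z = 0` is the first zero of `s`
(equivalently, the first critical point of `r`). -/
structure IsUnstableTrajectory (P : Params) (c ε : ℝ) (r s φ : ℝ → ℝ) : Prop where
  sol : P.IsSolution c ε r s φ
  r_pos : ∀ z ≤ 0, 0 < r z
  tendsto_rest : ∃ sₑ φₑ : ℝ, P.IsRestPoint c ε sₑ φₑ ∧
    Tendsto r atBot (𝓝 0) ∧ Tendsto s atBot (𝓝 sₑ) ∧ Tendsto φ atBot (𝓝 φₑ)
  s_zero : s 0 = 0
  s_pos : ∀ z < 0, 0 < s z

end Params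

/-- `φ_ε(z)`: the derivative at `ε = 0` of the `φ`-component `φ^u` of a family of trajectories,
the first argument of `φu` being `ε` and the second `z`. -/
def phiEps (φu : ℝ → ℝ → ℝ) (z : ℝ) : ℝ := deriv (fun ε => φu ε z) 0

end PCQNLS

end

/-! The weight `r²` is an integrating factor of the `φ`-equation: along a trajectory `(r² φ)' = -ε
r² (B₀ + B₁ r² + B₂ r⁴)`. Integrating from `-∞` to `0` and letting `ε → 0` gives `R₀(0)² φ_ε(0)` as
minus a half-line integral of a polynomial in `R₀²`. Evenness of `R₀` doubles it to a combination of
`Λ 2`, `Λ 4`, `Λ 6`, and `Λ₂' = Λ 4 + α Λ 6 - ω Λ 2` puts it in the stated form.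

What has to be justified is existence, uniqueness and smooth dependence on `ε`. In place of an
unstable manifold theorem, the half-trajectory is parametrized by `τ ∈ [0, 1]` with `r² = ρ (1 -
τ²)` and `s = τ / γ`: the rest point sits at `τ = 1`, the zero of `s` at `τ = 0`. The laws `(r² φ)'
= …` and `d(r² s²) = (φ² + A₀ - A₁ r² - A₂ r⁴) d(r²)` become integral equations for `(φ, γ, ρ)`.
After division by the factors vanishing at the two ends they form a C¹ equation on `C([0, 1])² × ℝ`.
At `ε = 0` its linearization is triangular and invertible because `√(1 - β) > 0`, so the implicit
function theorem applies (`exists_isProfile`); integrating `τ' = -(1 - τ²) / γ(τ)` recovers the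
trajectory (`exists_isUnstableTrajectory`).

Uniqueness (`IsUnstableTrajectory.eqOn`) compares two trajectories at equal `r`: their distance in
`(s, φ)` contracts forward near the rest point and tends to `0` at `-∞`, so it is zero. Hence every
admissible family satisfies `φ^u(0; ε) = -ε G(ε)` with `G` differentiable at `0`, which yields both
the `O(ε²)` remainder and `φ_ε(0) = -G(0)`. -/

noncomputable section

/-! ### Uniqueness of the trajectory. -/

/-- A nonnegative function that vanishes at `-∞` and whose logarithmic derivative is bounded above by
a continuous function with negative limit at `-∞` vanishes identically. -/
theorem eq_zero_of_hasDerivAt_le_mul_atBot {N N' k : ℝ → ℝ} {κ : ℝ}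
    (hN0 : ∀ z < 0, 0 ≤ N z) (hN : ∀ z < 0, HasDerivAt N (N' z) z)
    (hle : ∀ z < 0, N' z ≤ k z * N z) (hk : ContinuousOn k (Set.Iio 0))
    (hκ : κ < 0) (hlim : Tendsto k atBot (𝓝 κ)) (hNlim : Tendsto N atBot (𝓝 0)) :
    ∀ z < 0, N z = 0 := by
  obtain ⟨T, hT⟩ := eventually_atBot.1 (hlim.eventually (gt_mem_nhds hκ))
  set T' := min T (-1) with hT'
  have hT'0 : T' < 0 := lt_of_le_of_lt (min_le_right _ _) (by norm_num)
  have anti : AntitoneOn N (Set.Iic T') := by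
    refine antitoneOn_of_deriv_nonpos (convex_Iic _) (fun z hz => ?_) (fun z hz => ?_) ?_
    · exact (hN z (lt_of_le_of_lt hz hT'0)).continuousAt.continuousWithinAt
    · rw [interior_Iic] at hz
      exact (hN z (hz.trans hT'0)).differentiableAt.differentiableWithinAt
    · intro z hz
      rw [interior_Iic] at hz
      have hz0 : z < 0 := lt_trans hz hT'0
      rw [(hN z hz0).deriv]
      have h1 := hT z (hz.le.trans (min_le_left _ _))
      nlinarith [hle z hz0, hN0 z hz0]
  have zero1 : ∀ z ≤ T', N z = 0 := by
    intro z hz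
    refine le_antisymm ?_ (hN0 z (lt_of_le_of_lt hz hT'0))
    -- Near `-∞` the function `N` is nonincreasing, hence bounded above by its limit `0`.
    refine ge_of_tendsto hNlim ?_
    filter_upwards [eventually_le_atBot z] with y hy
    exact anti (hy.trans hz) hz hy
  intro z hz
  rcases le_total z T' with h | h
  · exact zero1 z h
  -- Beyond `T'` a Grönwall argument: with `k ≤ K` on the compact interval, `N e^{-K y}` is
  -- nonincreasing and starts from `0`.
  have hsub : Set.Icc T' z ⊆ Set.Iio 0 := fun y hy => lt_of_le_of_lt hy.2 hz
  obtain ⟨K, hK⟩ := (isCompact_Icc (a := T') (b := z)).bddAbove_image (hk.mono hsub)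
  have hK' : ∀ y ∈ Set.Icc T' z, k y ≤ K := fun y hy => hK (Set.mem_image_of_mem _ hy)
  have hd : ∀ y < 0, HasDerivAt (fun y => N y * Real.exp (-K * y))
      (N' y * Real.exp (-K * y) + N y * (Real.exp (-K * y) * (-K))) y := by
    intro y hy
    have := ((hasDerivAt_id y).const_mul (-K)).exp
    simp only [id, mul_one] at this
    exact (hN y hy).mul this
  have anti2 : AntitoneOn (fun y => N y * Real.exp (-K * y)) (Set.Icc T' z) := by
    refine antitoneOn_of_deriv_nonpos (convex_Icc _ _) (fun y hy => ?_) (fun y hy => ?_) ?_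
    · exact (hd y (hsub hy)).continuousAt.continuousWithinAt
    · exact (hd y (hsub (interior_subset hy))).differentiableAt.differentiableWithinAt
    · intro y hy
      have hy' := interior_subset hy
      rw [(hd y (hsub hy')).deriv]
      have h1 := hle y (hsub hy')
      have h2 := hN0 y (hsub hy')
      have h3 : k y * N y ≤ K * N y := mul_le_mul_of_nonneg_right (hK' y hy') h2
      have h4 := Real.exp_pos (-K * y)
      nlinarith
  have := anti2 (Set.left_mem_Icc.2 h) (Set.right_mem_Icc.2 h) h
  simp only [zero1 T' le_rfl, zero_mul] at this
  have h4 := Real.exp_pos (-K * z)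
  nlinarith [hN0 z hz]

/-- Two increasing positive functions on `(-∞, 0]` vanishing at `-∞` differ by a change of variables
in the independent variable. -/
theorem exists_reparametrization {r₁ s₁ r₂ s₂ : ℝ → ℝ}
    (hc₁ : ContinuousOn r₁ (Set.Iic 0)) (hc₂ : ContinuousOn r₂ (Set.Iic 0))
    (hp₁ : ∀ z ≤ 0, 0 < r₁ z) (hp₂ : ∀ z ≤ 0, 0 < r₂ z)
    (hd₁ : ∀ z < 0, HasDerivAt r₁ (r₁ z * s₁ z) z) (hd₂ : ∀ z < 0, HasDerivAt r₂ (r₂ z * s₂ z) z)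
    (hs₁ : ∀ z < 0, 0 < s₁ z) (hs₂ : ∀ z < 0, 0 < s₂ z)
    (hl₁ : Tendsto r₁ atBot (𝓝 0)) (hl₂ : Tendsto r₂ atBot (𝓝 0)) (h0 : r₁ 0 ≤ r₂ 0) :
    ∃ ζ : ℝ → ℝ, Tendsto ζ atBot atBot ∧ ∀ z < 0, ζ z < 0 ∧ r₂ (ζ z) = r₁ z ∧
      HasDerivAt ζ (s₁ z / s₂ (ζ z)) z := by
  have mono : ∀ {r s : ℝ → ℝ}, ContinuousOn r (Set.Iic 0) → (∀ z ≤ 0, 0 < r z) →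
      (∀ z < 0, HasDerivAt r (r z * s z) z) → (∀ z < 0, 0 < s z) →
      StrictMonoOn r (Set.Iic 0) := by
    intro r s hc hp hd hs
    refine strictMonoOn_of_deriv_pos (convex_Iic _) hc fun z hz => ?_
    rw [interior_Iic] at hz
    rw [(hd z hz).deriv]
    exact mul_pos (hp z (le_of_lt hz)) (hs z hz)
  have m₁ := mono hc₁ hp₁ hd₁ hs₁
  have m₂ := mono hc₂ hp₂ hd₂ hs₂
  have ex : ∀ z, ∃ w, z < 0 → w < 0 ∧ r₂ w = r₁ z := by
    intro z
    by_cases hz : z < 0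
    · obtain ⟨T, hT⟩ := eventually_atBot.1 (hl₂.eventually (gt_mem_nhds (hp₁ z hz.le)))
      have hT' := hT (min T 0) (min_le_left _ _)
      have hlt : r₁ z < r₂ 0 := (m₁ hz.le (Set.mem_Iic.2 le_rfl) hz).trans_le h0
      obtain ⟨w, hw, hw'⟩ := intermediate_value_Icc (min_le_right T 0)
        (hc₂.mono fun y hy => hy.2) ⟨hT'.le, hlt.le⟩
      refine ⟨w, fun _ => ⟨lt_of_le_of_ne hw.2 ?_, hw'⟩⟩
      rintro rfl
      exact hlt.ne hw'.symm
    -- For `z ≥ 0` nothing is required and the value `0` is arbitrary.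
    · exact ⟨0, fun h => absurd h hz⟩
  choose ζ hζ using ex
  refine ⟨ζ, ?_, fun z hz => ⟨(hζ z hz).1, (hζ z hz).2, ?_⟩⟩
  · refine tendsto_atBot.2 fun M => ?_
    have hM : min M 0 ≤ 0 := min_le_right _ _
    filter_upwards [hl₁.eventually (gt_mem_nhds (hp₂ _ hM)), eventually_lt_atBot 0] with z h1 hz
    by_contra! hcon
    have := m₂ hM (hζ z hz).1.le (lt_of_le_of_lt (min_le_left _ _) hcon)
    rw [(hζ z hz).2] at this
    exact lt_asymm this h1
  · have hζ0 := (hζ z hz).1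
    have hcont : ContinuousAt ζ z := by
      rw [ContinuousAt, tendsto_order]
      have hr := (hd₁ z hz).continuousAt
      constructor
      · intro c hc
        have h1 : r₂ c < r₁ z := (hζ z hz).2 ▸ m₂ (hc.trans hζ0).le hζ0.le hc
        filter_upwards [hr.eventually (lt_mem_nhds h1), gt_mem_nhds hz] with y hy hy0
        by_contra! hcon
        have := m₂.monotoneOn (hζ y hy0).1.le (hc.trans hζ0).le hcon
        rw [(hζ y hy0).2] at this
        exact not_lt_of_ge this hy
      · intro c hc
        rcases lt_or_ge c 0 with hc0 | hc0
        · have h1 : r₁ z < r₂ c := (hζ z hz).2 ▸ m₂ hζ0.le hc0.le hc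
          filter_upwards [hr.eventually (gt_mem_nhds h1), gt_mem_nhds hz] with y hy hy0
          by_contra! hcon
          have := m₂.monotoneOn hc0.le (hζ y hy0).1.le hcon
          rw [(hζ y hy0).2] at this
          exact not_lt_of_ge this hy
        · filter_upwards [gt_mem_nhds hz] with y hy0
          exact (hζ y hy0).1.trans_le hc0
    have hpos := mul_pos (hp₂ _ hζ0.le) (hs₂ _ hζ0)
    have := HasDerivAt.of_comp_left hcont (hd₂ _ hζ0) (hd₁ z hz) hpos.ne'
      (by filter_upwards [gt_mem_nhds hz] with y hy0 using (hζ y hy0).2)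
    rwa [(hζ z hz).2, mul_div_mul_left _ _ (hp₁ z hz.le).ne'] at this

/-- Growth of the squared distance between a solution `(s, φ)` of `s' = -s² + φ² + p`,
`φ' = -2sφ + q` and a solution `(t, ψ)` run at the relative speed `s / t`. -/
theorem sq_add_sq_growth (s t φ ψ p q : ℝ) (ht : 0 < t) :
    2 * (s - t) * ((-s ^ 2 + φ ^ 2 + p) - (-t ^ 2 + ψ ^ 2 + p) * (s / t)) +
      2 * (φ - ψ) * ((-2 * s * φ + q) - (-2 * t * ψ + q) * (s / t)) ≤
    (-2 * (s + t) + 2 * ((|-t ^ 2 + ψ ^ 2 + p| + |-2 * t * ψ + q|) / t)) *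
      ((s - t) ^ 2 + (φ - ψ) ^ 2) := by
  set A := -t ^ 2 + ψ ^ 2 + p
  set B := -2 * t * ψ + q
  -- With `w = s + iφ` the system is the complex Riccati equation `w' = -w² + p + iq`. A difference
  -- of squares factors through the sum, whose real part `s + t` is the contraction rate; the
  -- contributions of `φ + ψ` cancel in the final sum. The rest comes from `s / t = 1 + (s - t) /
  -- t`.
  have e1 : (-s ^ 2 + φ ^ 2 + p) - A * (s / t) =
      -(s + t) * (s - t) + (φ + ψ) * (φ - ψ) - A / t * (s - t) := by
    simp only [A]; field_simp; ring
  have e2 : (-2 * s * φ + q) - B * (s / t) =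
      -(s + t) * (φ - ψ) - (φ + ψ) * (s - t) - B / t * (s - t) := by
    simp only [B]; field_simp; ring
  rw [e1, e2, add_div |A|]
  have hA : |A / t| = |A| / t := by rw [abs_div, abs_of_pos ht]
  have hB : |B / t| = |B| / t := by rw [abs_div, abs_of_pos ht]
  rw [← hA, ← hB]
  generalize A / t = A'
  generalize B / t = B'
  have h1 := neg_abs_le A'
  have h2 := abs_nonneg A'
  have h3 : -(|B'| * ((s - t) ^ 2 + (φ - ψ) ^ 2)) ≤ B' * ((s - t) * (φ - ψ)) := by
    have : |B' * ((s - t) * (φ - ψ))| ≤ |B'| * ((s - t) ^ 2 + (φ - ψ) ^ 2) := by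
      rw [abs_mul]
      refine mul_le_mul_of_nonneg_left ?_ (abs_nonneg _)
      rw [abs_le]
      constructor <;> nlinarith [sq_nonneg ((s - t) + (φ - ψ)), sq_nonneg ((s - t) - (φ - ψ))]
    exact (abs_le.1 this).1
  have h4 : -(A' * (s - t) ^ 2) ≤ |A'| * ((s - t) ^ 2 + (φ - ψ) ^ 2) := by
    nlinarith [sq_nonneg (s - t), mul_nonneg h2 (sq_nonneg (φ - ψ))]
  nlinarith

namespace PCQNLS.Params

theorem Δ_pos (P : Params) (ε : ℝ) : 0 < P.Δ ε := by unfold Δ; positivity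

/-- The part of the right-hand side of the equation for `s` that depends only on `r`. -/
def fsr (P : Params) (ε r : ℝ) : ℝ := P.fs 0 ε r 0 0

/-- The part of the right-hand side of the equation for `φ` that depends only on `r`. -/
def fφr (P : Params) (ε r : ℝ) : ℝ := P.fφ 0 ε r 0 0

theorem fs_eq_add_fsr (P : Params) (ε r s φ : ℝ) :
    P.fs 0 ε r s φ = -s ^ 2 + φ ^ 2 + P.fsr ε r := by
  have := (P.Δ_pos ε).ne'
  unfold fsr fs
  field_simp
  ring

theorem fφ_eq_add_fφr (P : Params) (ε r s φ : ℝ) :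
    P.fφ 0 ε r s φ = -2 * s * φ + P.fφr ε r := by
  have := (P.Δ_pos ε).ne'
  unfold fφr fφ
  field_simp
  ring

/-- The equations prescribe the square of `s + iφ`, and only one of two opposite square roots has
positive real part. -/
theorem IsRestPoint.eq {P : Params} {ε s φ s' φ' : ℝ} (h : P.IsRestPoint 0 ε s φ)
    (h' : P.IsRestPoint 0 ε s' φ') : s = s' ∧ φ = φ' := by
  obtain ⟨p, e1, e2⟩ := h
  obtain ⟨p', e1', e2'⟩ := h'
  rw [fs_eq_add_fsr] at e1 e1'
  rw [fφ_eq_add_fφr] at e2 e2'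
  have h1 : (s - s') * (s + s') = (φ - φ') * (φ + φ') := by linear_combination e1' - e1
  have h2 : s * φ = s' * φ' := by linear_combination (e2' - e2) / 2
  have h3 : (s - s') * (φ + φ') + (s + s') * (φ - φ') = 0 := by linear_combination 2 * h2
  have h4 : (s - s') * ((s + s') ^ 2 + (φ + φ') ^ 2) = 0 := by
    linear_combination (s + s') * h1 + (φ + φ') * h3
  have h5 : s - s' = 0 := by
    rcases mul_eq_zero.1 h4 with h | h
    · exact h
    · nlinarith [sq_nonneg (φ + φ')]
  have h6 : s = s' := by linarith
  subst h6
  exact ⟨rfl, mul_left_cancel₀ p.ne' h2⟩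

namespace IsUnstableTrajectory

variable {P : Params} {ε : ℝ} {r₁ s₁ φ₁ r₂ s₂ φ₂ : ℝ → ℝ}

theorem hasDerivAt_r (h : P.IsUnstableTrajectory 0 ε r₁ s₁ φ₁) {z : ℝ} (hz : z < 0) :
    HasDerivAt r₁ (r₁ z * s₁ z) z :=
  (h.sol.hr z hz.le).hasDerivAt (Iic_mem_nhds hz)

theorem hasDerivAt_s (h : P.IsUnstableTrajectory 0 ε r₁ s₁ φ₁) {z : ℝ} (hz : z < 0) :
    HasDerivAt s₁ (-s₁ z ^ 2 + φ₁ z ^ 2 + P.fsr ε (r₁ z)) z := by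
  rw [← fs_eq_add_fsr]
  exact (h.sol.hs z hz.le).hasDerivAt (Iic_mem_nhds hz)

theorem hasDerivAt_φ (h : P.IsUnstableTrajectory 0 ε r₁ s₁ φ₁) {z : ℝ} (hz : z < 0) :
    HasDerivAt φ₁ (-2 * s₁ z * φ₁ z + P.fφr ε (r₁ z)) z := by
  rw [← fφ_eq_add_fφr]
  exact (h.sol.hφ z hz.le).hasDerivAt (Iic_mem_nhds hz)

theorem continuousOn_r (h : P.IsUnstableTrajectory 0 ε r₁ s₁ φ₁) :
    ContinuousOn r₁ (Set.Iic 0) := fun z hz => (h.sol.hr z hz).continuousWithinAt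

theorem continuousOn_s (h : P.IsUnstableTrajectory 0 ε r₁ s₁ φ₁) :
    ContinuousOn s₁ (Set.Iic 0) := fun z hz => (h.sol.hs z hz).continuousWithinAt

theorem continuousOn_φ (h : P.IsUnstableTrajectory 0 ε r₁ s₁ φ₁) :
    ContinuousOn φ₁ (Set.Iic 0) := fun z hz => (h.sol.hφ z hz).continuousWithinAt

/-- Along a trajectory, `s`, `φ` tend to the rest point, where the right-hand sides vanish. -/
theorem exists_limits (h : P.IsUnstableTrajectory 0 ε r₁ s₁ φ₁) :
    ∃ sₑ φₑ, P.IsRestPoint 0 ε sₑ φₑ ∧ Tendsto s₁ atBot (𝓝 sₑ) ∧ Tendsto φ₁ atBot (𝓝 φₑ) ∧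
      Tendsto (fun z => -s₁ z ^ 2 + φ₁ z ^ 2 + P.fsr ε (r₁ z)) atBot (𝓝 0) ∧
      Tendsto (fun z => -2 * s₁ z * φ₁ z + P.fφr ε (r₁ z)) atBot (𝓝 0) := by
  obtain ⟨sₑ, φₑ, he, hr, hs, hφ⟩ := h.tendsto_rest
  refine ⟨sₑ, φₑ, he, hs, hφ, ?_, ?_⟩
  · have h1 := he.fs_eq
    rw [fs_eq_add_fsr] at h1
    have hc : Continuous (P.fsr ε) := by unfold fsr fs; fun_prop
    rw [← h1]
    exact (((hs.pow 2).neg).add (hφ.pow 2)).add ((hc.tendsto 0).comp hr)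
  · have h1 := he.fφ_eq
    rw [fφ_eq_add_fφr] at h1
    have hc : Continuous (P.fφr ε) := by unfold fφr fφ; fun_prop
    rw [← h1]
    exact ((hs.const_mul (-2)).mul hφ).add ((hc.tendsto 0).comp hr)

/-- The second trajectory is run through `ζ` so that both have the same `r`; the forcing terms then
agree and the squared distance in `(s, φ)` obeys `sq_add_sq_growth`. Once it vanishes, `ζ` has unit
speed, so the trajectories are translates, and the normalization of the zero of `s` fixes the
translation. -/
theorem eqOn_of_le (h₁ : P.IsUnstableTrajectory 0 ε r₁ s₁ φ₁)
    (h₂ : P.IsUnstableTrajectory 0 ε r₂ s₂ φ₂) (h0 : r₁ 0 ≤ r₂ 0) :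
    Set.EqOn r₁ r₂ (Set.Iic 0) ∧ Set.EqOn s₁ s₂ (Set.Iic 0) ∧ Set.EqOn φ₁ φ₂ (Set.Iic 0) := by
  obtain ⟨s₁ₑ, φ₁ₑ, he₁, hs₁, hφ₁, -, -⟩ := h₁.exists_limits
  obtain ⟨s₂ₑ, φ₂ₑ, he₂, hs₂, hφ₂, hA, hB⟩ := h₂.exists_limits
  obtain ⟨rfl, rfl⟩ := he₁.eq he₂
  obtain ⟨-, -, -, hr₁, -⟩ := h₁.tendsto_rest
  obtain ⟨-, -, -, hr₂, -⟩ := h₂.tendsto_rest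
  obtain ⟨ζ, hζ, hζ'⟩ := exists_reparametrization h₁.continuousOn_r h₂.continuousOn_r h₁.r_pos
    h₂.r_pos (fun z => h₁.hasDerivAt_r) (fun z => h₂.hasDerivAt_r) h₁.s_pos h₂.s_pos hr₁ hr₂ h0
  have hζm : Set.MapsTo ζ (Set.Iio 0) (Set.Iio 0) := fun z hz => (hζ' z hz).1
  have hζc : ContinuousOn ζ (Set.Iio 0) := fun z hz =>
    (hζ' z hz).2.2.continuousAt.continuousWithinAt
  have key := eq_zero_of_hasDerivAt_le_mul_atBot
    (N := fun z => (s₁ z - s₂ (ζ z)) ^ 2 + (φ₁ z - φ₂ (ζ z)) ^ 2)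
    (k := fun z => -2 * (s₁ z + s₂ (ζ z)) +
      2 * ((|-s₂ (ζ z) ^ 2 + φ₂ (ζ z) ^ 2 + P.fsr ε (r₂ (ζ z))| +
        |-2 * s₂ (ζ z) * φ₂ (ζ z) + P.fφr ε (r₂ (ζ z))|) / s₂ (ζ z)))
    -- The right-hand sides vanish at the rest point, so this limit is `-4 s₁ₑ < 0`.
    (κ := -2 * (s₁ₑ + s₁ₑ) + 2 * ((|0| + |0|) / s₁ₑ))
    (fun z _ => by positivity)
    (fun z hz => (((h₁.hasDerivAt_s hz).sub
      ((h₂.hasDerivAt_s (hζ' z hz).1).comp z (hζ' z hz).2.2)).pow 2).add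
      (((h₁.hasDerivAt_φ hz).sub
      ((h₂.hasDerivAt_φ (hζ' z hz).1).comp z (hζ' z hz).2.2)).pow 2))
    (fun z hz => by
      have := sq_add_sq_growth (s₁ z) (s₂ (ζ z)) (φ₁ z) (φ₂ (ζ z)) (P.fsr ε (r₂ (ζ z)))
        (P.fφr ε (r₂ (ζ z))) (h₂.s_pos _ (hζ' z hz).1)
      simp only [(hζ' z hz).2.1] at this ⊢
      convert this using 1
      simp)
    (by
      have hc1 : Continuous (P.fsr ε) := by unfold fsr fs; fun_prop
      have hc2 : Continuous (P.fφr ε) := by unfold fφr fφ; fun_prop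
      have a1 : ContinuousOn s₁ (Set.Iio 0) := h₁.continuousOn_s.mono Set.Iio_subset_Iic_self
      have a2 : ContinuousOn (fun z => s₂ (ζ z)) (Set.Iio 0) :=
        (h₂.continuousOn_s.mono Set.Iio_subset_Iic_self).comp hζc hζm
      have a3 : ContinuousOn (fun z => φ₂ (ζ z)) (Set.Iio 0) :=
        (h₂.continuousOn_φ.mono Set.Iio_subset_Iic_self).comp hζc hζm
      have a4 : ContinuousOn (fun z => r₂ (ζ z)) (Set.Iio 0) :=
        (h₂.continuousOn_r.mono Set.Iio_subset_Iic_self).comp hζc hζm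
      have a5 := hc1.comp_continuousOn a4
      have a6 := hc2.comp_continuousOn a4
      have a7 : ∀ z ∈ Set.Iio (0 : ℝ), s₂ (ζ z) ≠ 0 := fun z hz => (h₂.s_pos _ (hζ' z hz).1).ne'
      exact (continuousOn_const.mul (a1.add a2)).add
        (continuousOn_const.mul (((((a2.pow 2).neg.add (a3.pow 2)).add a5).abs.add
          (((continuousOn_const.mul a2).mul a3).add a6).abs).div a2 a7)))
    (by simp; linarith [he₁.pos])
    (((hs₁.add (hs₂.comp hζ)).const_mul _).add
      ((((hA.comp hζ).abs.add (hB.comp hζ).abs).div (hs₂.comp hζ) he₁.pos.ne').const_mul _))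
    (by
      have := ((hs₁.sub (hs₂.comp hζ)).pow 2).add ((hφ₁.sub (hφ₂.comp hζ)).pow 2)
      simpa using this)
  have hseq : ∀ z < 0, s₁ z = s₂ (ζ z) := fun z hz => by
    have : (s₁ z - s₂ (ζ z)) ^ 2 + (φ₁ z - φ₂ (ζ z)) ^ 2 = 0 := key z hz
    nlinarith [sq_nonneg (s₁ z - s₂ (ζ z)), sq_nonneg (φ₁ z - φ₂ (ζ z))]
  have hφeq : ∀ z < 0, φ₁ z = φ₂ (ζ z) := fun z hz => by
    have : (s₁ z - s₂ (ζ z)) ^ 2 + (φ₁ z - φ₂ (ζ z)) ^ 2 = 0 := key z hz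
    nlinarith [sq_nonneg (s₁ z - s₂ (ζ z)), sq_nonneg (φ₁ z - φ₂ (ζ z))]
  have hζ1 : ∀ z < 0, HasDerivAt ζ 1 z := fun z hz => by
    have := (hζ' z hz).2.2
    rwa [hseq z hz, div_self (h₂.s_pos _ (hζ' z hz).1).ne'] at this
  obtain ⟨c, hc⟩ : ∃ c, ∀ z < 0, ζ z = z + c := by
    obtain ⟨c, hc⟩ := isOpen_Iio.exists_is_const_of_deriv_eq_zero (𝕜 := ℝ)
      (s := Set.Iio (0 : ℝ)) (f := fun z => ζ z - z) isPreconnected_Iio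
      (fun z hz => ((hζ1 z hz).sub (hasDerivAt_id z)).differentiableAt.differentiableWithinAt)
      (fun z hz => by simpa using ((hζ1 z hz).fun_sub (hasDerivAt_id z)).deriv)
    exact ⟨c, fun z hz => by linarith [hc z hz]⟩
  have lim : ∀ {f : ℝ → ℝ} {c : ℝ}, c ≤ 0 → ContinuousOn f (Set.Iic 0) →
      Tendsto (fun z => f (z + c)) (𝓝[<] 0) (𝓝 (f c)) := by
    intro f c hc hf
    have h1 : Tendsto (fun z => z + c) (𝓝[<] 0) (𝓝[Set.Iic 0] c) := by
      refine tendsto_nhdsWithin_iff.2 ⟨?_, ?_⟩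
      · have : Continuous fun z : ℝ => z + c := by fun_prop
        simpa using (this.tendsto 0).mono_left nhdsWithin_le_nhds
      · filter_upwards [self_mem_nhdsWithin] with z hz
        have : z < 0 := hz
        simp only [Set.mem_Iic]; linarith
    exact (hf c hc).tendsto.comp h1
  have lim0 : ∀ {f : ℝ → ℝ}, ContinuousOn f (Set.Iic 0) → Tendsto f (𝓝[<] 0) (𝓝 (f 0)) :=
    fun hf => by simpa using lim le_rfl hf
  have hc0 : c ≤ 0 := by
    by_contra! hcon
    have := (hζ' (-(c / 2)) (by linarith)).1
    rw [hc _ (by linarith)] at this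
    linarith
  -- Letting `z → 0⁻` gives `s₂ c = s₁ 0 = 0`, which is impossible for `c < 0`.
  have hsc : s₂ c = 0 := by
    rw [← h₁.s_zero]
    refine tendsto_nhds_unique (lim hc0 h₂.continuousOn_s) ((lim0 h₁.continuousOn_s).congr' ?_)
    filter_upwards [self_mem_nhdsWithin] with z hz
    rw [hseq z hz, hc z hz]
  obtain rfl : c = 0 := by
    by_contra hne
    exact (h₂.s_pos c (lt_of_le_of_ne hc0 hne)).ne' hsc
  have ext : ∀ {f g : ℝ → ℝ}, ContinuousOn f (Set.Iic 0) → ContinuousOn g (Set.Iic 0) →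
      (∀ z < 0, f z = g (ζ z)) → Set.EqOn f g (Set.Iic 0) := by
    intro f g hf hg hfg z hz
    have hlt : ∀ z < 0, f z = g z := fun z hz => by rw [hfg z hz, hc z hz, add_zero]
    rcases lt_or_eq_of_le (Set.mem_Iic.1 hz) with hz | rfl
    · exact hlt z hz
    · refine tendsto_nhds_unique (lim0 hf) ((lim0 hg).congr' ?_)
      filter_upwards [self_mem_nhdsWithin] with z hz using (hlt z hz).symm
  exact ⟨ext h₁.continuousOn_r h₂.continuousOn_r fun z hz => (hζ' z hz).2.1.symm,
    ext h₁.continuousOn_s h₂.continuousOn_s hseq, ext h₁.continuousOn_φ h₂.continuousOn_φ hφeq⟩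

theorem eqOn (h₁ : P.IsUnstableTrajectory 0 ε r₁ s₁ φ₁)
    (h₂ : P.IsUnstableTrajectory 0 ε r₂ s₂ φ₂) :
    Set.EqOn r₁ r₂ (Set.Iic 0) ∧ Set.EqOn s₁ s₂ (Set.Iic 0) ∧ Set.EqOn φ₁ φ₂ (Set.Iic 0) := by
  rcases le_total (r₁ 0) (r₂ 0) with h | h
  · exact h₁.eqOn_of_le h₂ h
  · obtain ⟨a, b, c⟩ := h₂.eqOn_of_le h₁ h
    exact ⟨a.symm, b.symm, c.symm⟩

end IsUnstableTrajectory

end PCQNLS.Params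

/-! ### From profiles on `[0, 1]` to trajectories. -/

theorem Continuous.hasDerivAt_integral_left {f : ℝ → ℝ} (hf : Continuous f) (a b : ℝ) :
    HasDerivAt (fun t => ∫ x in t..b, f x) (-f a) a :=
  intervalIntegral.integral_hasDerivAt_left (hf.intervalIntegrable _ _)
    hf.stronglyMeasurable.stronglyMeasurableAtFilter hf.continuousAt

theorem Real.hasDerivAt_tanh (x : ℝ) : HasDerivAt Real.tanh (1 - Real.tanh x ^ 2) x := by
  have h := (Real.hasDerivAt_sinh x).div (Real.hasDerivAt_cosh x) (Real.cosh_pos x).ne'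
  have e : Real.tanh = fun x => Real.sinh x / Real.cosh x :=
    funext Real.tanh_eq_sinh_div_cosh
  have hc := (Real.cosh_pos x).ne'
  rw [e]
  convert! h using 1
  field_simp

theorem Real.tendsto_tanh_atTop : Tendsto Real.tanh atTop (𝓝 1) := by
  refine tendsto_order.2 ⟨fun c hc => ?_, fun c hc =>
    Eventually.of_forall fun x => (Real.tanh_lt_one x).trans hc⟩
  have mono : StrictMono Real.tanh := strictMono_of_deriv_pos fun x => by
    rw [(Real.hasDerivAt_tanh x).deriv]
    nlinarith [Real.tanh_lt_one x, Real.neg_one_lt_tanh x]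
  have hm : max c 0 < 1 := max_lt hc one_pos
  filter_upwards [eventually_gt_atTop (Real.artanh (max c 0))] with x hx
  have := mono hx
  rw [Real.tanh_artanh ⟨by linarith [le_max_right c 0], hm⟩] at this
  exact (le_max_left _ _).trans_lt this

/-- The solution of `τ' = -(1 - τ²) / γ(τ)`, `τ(0) = 0` runs backwards from `0` to `1`. -/
theorem exists_solution_tanh_clock {γ : ℝ → ℝ} (hγ : Continuous γ) {c : ℝ} (hc : 0 < c)
    (hcγ : ∀ t, c ≤ γ t) :
    ∃ τ : ℝ → ℝ, Continuous τ ∧ τ 0 = 0 ∧ (∀ z < 0, 0 < τ z) ∧ (∀ z, τ z < 1) ∧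
      Tendsto τ atBot (𝓝 1) ∧ ∀ z, HasDerivAt τ (-(1 - τ z ^ 2) / γ (τ z)) z := by
  have htc : Continuous Real.tanh :=
    continuous_iff_continuousAt.2 fun x => (Real.hasDerivAt_tanh x).continuousAt
  -- Putting `τ = tanh θ` turns the equation into `θ' = -1 / γ(tanh θ)`, so `z = -Z(θ)`, and
  -- inverting `Z` solves it. The bound `γ ≥ c` makes `Z` onto, so the rest point is reached only at
  -- `z = -∞`.
  set Z : ℝ → ℝ := fun θ => ∫ t in (0 : ℝ)..θ, γ (Real.tanh t) with hZ
  have hZd : ∀ θ, HasDerivAt Z (γ (Real.tanh θ)) θ := fun θ =>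
    (hγ.comp htc).integral_hasStrictDerivAt 0 θ |>.hasDerivAt
  have hmono : StrictMono Z := strictMono_of_deriv_pos fun θ => by
    rw [(hZd θ).deriv]; exact hc.trans_le (hcγ _)
  have hZ0 : Z 0 = 0 := by simp [hZ]
  have hmono' : Monotone fun θ => Z θ - c * θ := by
    refine monotone_of_deriv_nonneg
      (fun θ => ((hZd θ).sub ((hasDerivAt_id θ).const_mul c)).differentiableAt) fun θ => ?_
    have := ((hZd θ).fun_sub ((hasDerivAt_id θ).const_mul c)).deriv
    simp only [id, mul_one] at this
    rw [this]
    linarith [hcγ (Real.tanh θ)]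
  have hsurj : Function.Surjective Z := by
    refine Continuous.surjective (continuous_iff_continuousAt.2 fun x => (hZd x).continuousAt) ?_ ?_
    · refine tendsto_atTop_mono' _ ?_ (tendsto_id.const_mul_atTop hc)
      filter_upwards [eventually_ge_atTop 0] with θ hθ
      have := hmono' hθ
      simp only [hZ0] at this
      simp only [id]; linarith
    · refine tendsto_atBot_mono' _ ?_ (tendsto_id.const_mul_atBot hc)
      filter_upwards [eventually_le_atBot 0] with θ hθ
      have := hmono' hθ
      simp only [hZ0] at this
      simp only [id]; linarith
  set e := hmono.orderIsoOfSurjective Z hsurj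
  have he : ∀ y, Z (e.symm y) = y := fun y => e.apply_symm_apply y
  have he0 : e.symm 0 = 0 := by
    rw [OrderIso.symm_apply_eq]; exact hZ0.symm
  have hed : ∀ y, HasDerivAt e.symm (γ (Real.tanh (e.symm y)))⁻¹ y := fun y =>
    HasDerivAt.of_local_left_inverse e.symm.continuous.continuousAt (hZd _)
      (hc.trans_le (hcγ _)).ne' (Eventually.of_forall he)
  have hτd : ∀ z, HasDerivAt (fun z => Real.tanh (e.symm (-z)))
      (-(1 - Real.tanh (e.symm (-z)) ^ 2) / γ (Real.tanh (e.symm (-z)))) z := by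
    intro z
    have := (Real.hasDerivAt_tanh _).comp z ((hed (-z)).comp z (hasDerivAt_neg z))
    simp only [Function.comp] at this
    convert! this using 1
    ring
  refine ⟨fun z => Real.tanh (e.symm (-z)),
    continuous_iff_continuousAt.2 fun z => (hτd z).continuousAt, by simp [he0], fun z hz => ?_,
    fun z => Real.tanh_lt_one _, ?_, hτd⟩
  · have : 0 < e.symm (-z) := by
      rw [← he0]; exact e.symm.strictMono (neg_pos.2 hz)
    simp only [Real.tanh_eq_sinh_div_cosh]
    exact div_pos (Real.sinh_pos_iff.2 this) (Real.cosh_pos _)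
  · exact Real.tendsto_tanh_atTop.comp (e.symm.tendsto_atTop.comp tendsto_neg_atBot_atTop)

/-- Supplies the one-sided equations at `z = 0`, where `τ = 0` is an endpoint of the interval on
which the profile relations hold. -/
theorem hasDerivWithinAt_Iic_of_forall_lt {f g : ℝ → ℝ} (hf : Continuous f) (hg : Continuous g)
    {a : ℝ} (h : ∀ z < a, HasDerivAt f (g z) z) :
    ∀ z ≤ a, HasDerivWithinAt f (g z) (Set.Iic a) z := by
  intro z hz
  rcases lt_or_eq_of_le hz with hz | rfl
  · exact (h z hz).hasDerivWithinAt
  · refine hasDerivWithinAt_Iic_of_tendsto_deriv (s := Set.Iio z)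
      (fun y hy => (h y hy).differentiableAt.differentiableWithinAt)
      hf.continuousWithinAt self_mem_nhdsWithin ?_
    refine ((hg.tendsto z).mono_left nhdsWithin_le_nhds).congr' ?_
    filter_upwards [self_mem_nhdsWithin] with y hy using (h y hy).deriv.symm

namespace PCQNLS.Params

/-- The right-hand side of the `s`-equation is `-s² + φ² + A₀ - A₁ r² - A₂ r⁴`. -/
def A₀ (P : Params) (ε : ℝ) : ℝ := (P.ω - ε ^ 2 * P.a * P.b) / P.Δ ε

/-- The coefficient of `-r²` in the `s`-equation. -/
def A₁ (P : Params) (ε : ℝ) : ℝ := (1 + ε ^ 2 * P.a * P.d₁) / P.Δ ε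

/-- The coefficient of `-r⁴` in the `s`-equation. -/
def A₂ (P : Params) (ε : ℝ) : ℝ := (P.α + ε ^ 2 * P.a * P.d₂) / P.Δ ε

/-- The right-hand side of the `φ`-equation is `-2 s φ - ε (B₀ + B₁ r² + B₂ r⁴)`. -/
def B₀ (P : Params) (ε : ℝ) : ℝ := (P.b + P.a * P.ω) / P.Δ ε

/-- The coefficient of `-ε r²` in the `φ`-equation. -/
def B₁ (P : Params) (ε : ℝ) : ℝ := (P.d₁ - P.a) / P.Δ ε

/-- The coefficient of `-ε r⁴` in the `φ`-equation. -/
def B₂ (P : Params) (ε : ℝ) : ℝ := (P.d₂ - P.a * P.α) / P.Δ ε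

theorem fs_zero_speed (P : Params) (ε r s φ : ℝ) :
    P.fs 0 ε r s φ = -s ^ 2 + φ ^ 2 + (P.A₀ ε - P.A₁ ε * r ^ 2 - P.A₂ ε * (r ^ 2) ^ 2) := by
  have := (P.Δ_pos ε).ne'
  unfold fs A₀ A₁ A₂
  field_simp
  ring

theorem fφ_zero_speed (P : Params) (ε r s φ : ℝ) :
    P.fφ 0 ε r s φ = -2 * s * φ - ε * (P.B₀ ε + P.B₁ ε * r ^ 2 + P.B₂ ε * (r ^ 2) ^ 2) := by
  have := (P.Δ_pos ε).ne'
  unfold fφ B₀ B₁ B₂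
  field_simp
  ring

/-- The trajectory in the parametrization `r² = ρ (1 - τ²)`, `s = τ / γ`, with `ρ = r(0)²`. -/
structure IsProfile (P : Params) (ε ρ : ℝ) (φ γ : ℝ → ℝ) : Prop where
  ρ_pos : 0 < ρ
  continuous_φ : Continuous φ
  continuous_γ : Continuous γ
  γ_ge : ∃ c > 0, ∀ t, c ≤ γ t
  -- The integrated law for `r² φ`, divided by `ρ`; here `r² dz = -ρ γ dτ`.
  φ_eq : ∀ τ ∈ Set.Icc (0 : ℝ) 1, (1 - τ ^ 2) * φ τ = -ε * ∫ σ in τ..1,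
    (P.B₀ ε + P.B₁ ε * (ρ * (1 - σ ^ 2)) + P.B₂ ε * (ρ * (1 - σ ^ 2)) ^ 2) * γ σ
  -- The integrated law for `r² s²`, divided by `ρ` and multiplied by `γ²`.
  γ_eq : ∀ τ ∈ Set.Icc (0 : ℝ) 1, (1 - τ ^ 2) * τ ^ 2 = γ τ ^ 2 * ((1 - τ ^ 2) *
    (P.A₀ ε - P.A₁ ε * (ρ * (1 - τ ^ 2)) / 2 - P.A₂ ε * (ρ * (1 - τ ^ 2)) ^ 2 / 3) +
      ∫ σ in τ..1, 2 * σ * φ σ ^ 2)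
  -- At `τ = 1` both relations above read `0 = 0`, so the rest point conditions are recorded
  -- separately.
  rest_s : 1 = γ 1 ^ 2 * (P.A₀ ε + φ 1 ^ 2)
  rest_φ : 2 * φ 1 = -ε * P.B₀ ε * γ 1

namespace IsProfile

variable {P : Params} {ε ρ : ℝ} {φ γ τ : ℝ → ℝ}

theorem γ_pos (h : P.IsProfile ε ρ φ γ) (t : ℝ) : 0 < γ t := by
  obtain ⟨c, hc, h'⟩ := h.γ_ge
  exact hc.trans_le (h' t)

theorem hasDerivAt_r (h : P.IsProfile ε ρ φ γ) {z : ℝ} (h0 : 0 < τ z) (h1 : τ z < 1)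
    (hd : HasDerivAt τ (-(1 - τ z ^ 2) / γ (τ z)) z) :
    HasDerivAt (fun z => √(ρ * (1 - τ z ^ 2))) (√(ρ * (1 - τ z ^ 2)) * (τ z / γ (τ z))) z := by
  have hx : 0 < 1 - τ z ^ 2 := by nlinarith
  have hpos : 0 < ρ * (1 - τ z ^ 2) := mul_pos h.ρ_pos hx
  have hγ := (h.γ_pos (τ z)).ne'
  have := (((hd.fun_pow 2).const_sub 1).const_mul ρ).sqrt hpos.ne'
  convert! this using 1
  have hs := Real.sqrt_pos.2 hpos
  rw [eq_div_iff (by positivity)]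
  have hsq := Real.sq_sqrt hpos.le
  field_simp
  rw [hsq]
  push_cast
  ring

theorem hasDerivAt_φ (h : P.IsProfile ε ρ φ γ) {z : ℝ} (h0 : 0 < τ z) (h1 : τ z < 1)
    (hd : HasDerivAt τ (-(1 - τ z ^ 2) / γ (τ z)) z) :
    HasDerivAt (fun z => φ (τ z)) (-2 * (τ z / γ (τ z)) * φ (τ z) -
      ε * (P.B₀ ε + P.B₁ ε * (ρ * (1 - τ z ^ 2)) + P.B₂ ε * (ρ * (1 - τ z ^ 2)) ^ 2)) z := by
  have hx : 0 < 1 - τ z ^ 2 := by nlinarith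
  have hγ := (h.γ_pos (τ z)).ne'
  set f : ℝ → ℝ := fun σ =>
    (P.B₀ ε + P.B₁ ε * (ρ * (1 - σ ^ 2)) + P.B₂ ε * (ρ * (1 - σ ^ 2)) ^ 2) * γ σ with hf
  have hfc : Continuous f := by have := h.continuous_γ; fun_prop
  have hF := (((hfc.hasDerivAt_integral_left (τ z) 1).const_mul (-ε)).fun_div
    (((hasDerivAt_id (τ z)).fun_pow 2).const_sub 1) hx.ne').comp z hd
  have heq : (fun z => φ (τ z)) =ᶠ[𝓝 z]
      (fun t => (-ε * ∫ σ in t..1, f σ) / (1 - id t ^ 2)) ∘ τ := by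
    filter_upwards [hd.continuousAt.eventually (lt_mem_nhds h0),
      hd.continuousAt.eventually (gt_mem_nhds h1)] with y hy0 hy1
    have : 0 < 1 - τ y ^ 2 := by nlinarith
    simp only [Function.comp, id]
    rw [eq_div_iff this.ne', mul_comm, h.φ_eq _ ⟨hy0.le, hy1.le⟩]
  convert! hF.congr_of_eventuallyEq heq using 1
  have e := h.φ_eq (τ z) ⟨h0.le, h1.le⟩
  change _ = -ε * ∫ σ in (τ z)..1, f σ at e
  rw [← e]
  simp only [hf, id]
  field_simp
  push_cast
  ring

/-- `γ` is only assumed continuous, so `τ / γ` cannot be differentiated as a quotient. Instead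
`γ_eq` expresses `s²` as a differentiable function `G` of `τ`, and `s = √G` since `s > 0`. -/
theorem hasDerivAt_s (h : P.IsProfile ε ρ φ γ) {z : ℝ} (h0 : 0 < τ z) (h1 : τ z < 1)
    (hd : HasDerivAt τ (-(1 - τ z ^ 2) / γ (τ z)) z) :
    HasDerivAt (fun z => τ z / γ (τ z)) (-(τ z / γ (τ z)) ^ 2 + φ (τ z) ^ 2 +
      (P.A₀ ε - P.A₁ ε * (ρ * (1 - τ z ^ 2)) - P.A₂ ε * (ρ * (1 - τ z ^ 2)) ^ 2)) z := by
  have hx : 0 < 1 - τ z ^ 2 := by nlinarith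
  have hγ := h.γ_pos (τ z)
  set f : ℝ → ℝ := fun σ => 2 * σ * φ σ ^ 2 with hf
  have hfc : Continuous f := by have := h.continuous_φ; fun_prop
  set G : ℝ → ℝ := fun t => P.A₀ ε - P.A₁ ε * (ρ * (1 - id t ^ 2)) / 2 -
    P.A₂ ε * (ρ * (1 - id t ^ 2)) ^ 2 / 3 + (∫ σ in t..1, f σ) / (1 - id t ^ 2) with hG
  have hGs : ∀ t, 0 < t → t < 1 → G t = (t / γ t) ^ 2 := by
    intro t ht0 ht1
    have hx : 0 < 1 - t ^ 2 := by nlinarith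
    have hγ := h.γ_pos t
    have e := h.γ_eq t ⟨ht0.le, ht1.le⟩
    change _ = γ t ^ 2 * (_ + ∫ σ in t..1, f σ) at e
    simp only [hG, id]
    rw [div_pow, eq_div_iff (by positivity)]
    field_simp
    linear_combination -6 * e
  have hspos : 0 < τ z / γ (τ z) := div_pos h0 hγ
  have hx1 := (((hasDerivAt_id (τ z)).fun_pow 2).const_sub 1).const_mul ρ
  have hGd := ((((hx1.const_mul (P.A₁ ε)).div_const 2).const_sub (P.A₀ ε)).fun_sub
    (((hx1.fun_pow 2).const_mul (P.A₂ ε)).div_const 3)).fun_add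
    ((hfc.hasDerivAt_integral_left (τ z) 1).fun_div
      (((hasDerivAt_id (τ z)).fun_pow 2).const_sub 1) hx.ne')
  have hne : G (τ z) ≠ 0 := by rw [hGs _ h0 h1]; positivity
  have hF := (HasDerivAt.sqrt hGd hne).comp z hd
  have heq : (fun z => τ z / γ (τ z)) =ᶠ[𝓝 z] (fun t => √(G t)) ∘ τ := by
    filter_upwards [hd.continuousAt.eventually (lt_mem_nhds h0),
      hd.continuousAt.eventually (gt_mem_nhds h1)] with y hy0 hy1
    simp only [Function.comp]
    rw [hGs _ hy0 hy1, Real.sqrt_sq (div_pos hy0 (h.γ_pos _)).le]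
  convert! hF.congr_of_eventuallyEq heq using 1
  change _ = _ / (2 * √(G (τ z))) * _
  have e := hGs _ h0 h1
  rw [e, Real.sqrt_sq hspos.le, ← e]
  simp only [hf, hG, id]
  field_simp
  push_cast
  ring

/-- A profile gives rise to a trajectory. -/
theorem exists_isUnstableTrajectory (h : P.IsProfile ε ρ φ γ) :
    ∃ τ : ℝ → ℝ, Continuous τ ∧ τ 0 = 0 ∧ (∀ z < 0, 0 < τ z) ∧ (∀ z, τ z < 1) ∧
      Tendsto τ atBot (𝓝 1) ∧ (∀ z, HasDerivAt τ (-(1 - τ z ^ 2) / γ (τ z)) z) ∧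
      P.IsUnstableTrajectory 0 ε (fun z => √(ρ * (1 - τ z ^ 2))) (fun z => τ z / γ (τ z))
        (fun z => φ (τ z)) := by
  obtain ⟨c, hc, hcγ⟩ := h.γ_ge
  obtain ⟨τ, hτc, hτ0, hτpos, hτ1, hτlim, hτd⟩ := exists_solution_tanh_clock h.continuous_γ hc hcγ
  have hφc : Continuous fun z => φ (τ z) := h.continuous_φ.comp hτc
  have hγc : Continuous fun z => γ (τ z) := h.continuous_γ.comp hτc
  have hsc : Continuous fun z => τ z / γ (τ z) := hτc.div hγc fun z => (h.γ_pos _).ne'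
  have hrc : Continuous fun z => √(ρ * (1 - τ z ^ 2)) := by fun_prop
  have hnn : ∀ z ≤ 0, 0 ≤ τ z := fun z hz => by
    rcases lt_or_eq_of_le hz with hz | rfl
    · exact (hτpos z hz).le
    · exact hτ0.ge
  have hxpos : ∀ z ≤ 0, 0 < ρ * (1 - τ z ^ 2) := fun z hz =>
    mul_pos h.ρ_pos (by nlinarith [hnn z hz, hτ1 z])
  have hγ1 := h.γ_pos 1
  refine ⟨τ, hτc, hτ0, hτpos, hτ1, hτlim, hτd, ⟨?_, ?_, ?_⟩, ?_, ?_, by simp [hτ0], ?_⟩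
  · exact hasDerivWithinAt_Iic_of_forall_lt hrc (hrc.mul hsc)
      fun z hz => h.hasDerivAt_r (hτpos z hz) (hτ1 z) (hτd z)
  · refine hasDerivWithinAt_Iic_of_forall_lt hsc ?_ fun z hz => ?_
    · simp only [fs_zero_speed]
      exact ((hsc.pow 2).neg.add (hφc.pow 2)).add (by fun_prop)
    · rw [fs_zero_speed, Real.sq_sqrt (hxpos z hz.le).le]
      exact h.hasDerivAt_s (hτpos z hz) (hτ1 z) (hτd z)
  · refine hasDerivWithinAt_Iic_of_forall_lt hφc ?_ fun z hz => ?_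
    · simp only [fφ_zero_speed]
      exact ((continuous_const.mul hsc).mul hφc).sub (by fun_prop)
    · rw [fφ_zero_speed, Real.sq_sqrt (hxpos z hz.le).le]
      exact h.hasDerivAt_φ (hτpos z hz) (hτ1 z) (hτd z)
  · exact fun z hz => Real.sqrt_pos.2 (hxpos z hz)
  · refine ⟨1 / γ 1, φ 1, ⟨by positivity, ?_, ?_⟩, ?_, ?_, ?_⟩
    · rw [fs_zero_speed]
      have := h.rest_s
      field_simp
      linear_combination -this
    · rw [fφ_zero_speed]
      have := h.rest_φ
      field_simp
      linear_combination -this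
    · have : Continuous fun t : ℝ => √(ρ * (1 - t ^ 2)) := by fun_prop
      simpa [Function.comp_def] using (this.tendsto 1).comp hτlim
    · exact hτlim.div ((h.continuous_γ.tendsto 1).comp hτlim) hγ1.ne'
    · exact (h.continuous_φ.tendsto 1).comp hτlim
  · exact fun z hz => div_pos (hτpos z hz) (h.γ_pos _)

end IsProfile

end PCQNLS.Params

/-! ### The profile equation on `C([0, 1])`. -/

namespace PCQNLS

/-- The continuous extension of a function on `[0, 1]` to the real line by constants. -/
def ext (f : C(unitInterval, ℝ)) : ℝ → ℝ := Set.IccExtend zero_le_one f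

theorem continuous_ext (f : C(unitInterval, ℝ)) : Continuous (ext f) := f.continuous.Icc_extend'

theorem ext_coe (f : C(unitInterval, ℝ)) (t : unitInterval) : ext f t = f t :=
  Set.IccExtend_val _ _ _

theorem ext_of_mem (f : C(unitInterval, ℝ)) {t : ℝ} (ht : t ∈ Set.Icc (0 : ℝ) 1) :
    ext f t = f ⟨t, ht⟩ :=
  Set.IccExtend_of_mem _ _ ht

/-- The operator `f ↦ (t ↦ ∫ u in 0..1, k t u * f (h t u))` on `C([0, 1])`. -/
def kernelOp (k h : C(unitInterval × ℝ, ℝ)) : C(unitInterval, ℝ) →L[ℝ] C(unitInterval, ℝ) :=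
  LinearMap.mkContinuousOfExistsBound
    { toFun := fun f => ⟨fun t => ∫ u in (0 : ℝ)..1, k (t, u) * ext f (h (t, u)),
        intervalIntegral.continuous_parametric_intervalIntegral_of_continuous'
          (k.continuous.mul ((continuous_ext f).comp h.continuous)) 0 1⟩
      map_add' := fun f g => by
        have hc : ∀ (f : C(unitInterval, ℝ)) (t : unitInterval), Continuous fun u => k (t, u) * ext f (h (t, u)) :=
          fun f t => by have := continuous_ext f; fun_prop
        ext t
        simp only [ContinuousMap.coe_mk, ContinuousMap.add_apply]
        rw [← intervalIntegral.integral_add ((hc f t).intervalIntegrable _ _)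
          ((hc g t).intervalIntegrable _ _)]
        refine intervalIntegral.integral_congr fun u _ => ?_
        simp [ext, Set.IccExtend, mul_add]
      map_smul' := fun c f => by
        ext t
        simp only [ContinuousMap.coe_mk, ContinuousMap.smul_apply, RingHom.id_apply, smul_eq_mul]
        rw [← intervalIntegral.integral_const_mul]
        refine intervalIntegral.integral_congr fun u _ => ?_
        simp [ext, Set.IccExtend]
        ring }
    (by
      obtain ⟨C, hC⟩ := ((isCompact_univ (X := unitInterval)).prod (isCompact_Icc (a := (0 : ℝ)) (b := 1))
        ).exists_bound_of_continuousOn k.continuous.continuousOn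
      have hC0 : 0 ≤ C := (norm_nonneg _).trans (hC (0, 0) (by simp))
      refine ⟨C, fun f => (ContinuousMap.norm_le _ (by positivity)).2 fun t => ?_⟩
      have := intervalIntegral.norm_integral_le_of_norm_le_const (a := (0 : ℝ)) (b := 1)
        (f := fun u => k (t, u) * ext f (h (t, u))) (C := C * ‖f‖) fun u hu => by
          rw [Set.uIoc_of_le zero_le_one] at hu
          rw [norm_mul]
          exact mul_le_mul (hC (t, u) ⟨trivial, hu.1.le, hu.2⟩) (f.norm_coe_le_norm _)
            (norm_nonneg _) hC0
      simpa using this)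

theorem kernelOp_apply (k h : C(unitInterval × ℝ, ℝ)) (f : C(unitInterval, ℝ)) (t : unitInterval) :
    kernelOp k h f t = ∫ u in (0 : ℝ)..1, k (t, u) * ext f (h (t, u)) := rfl

/-- The operator `f ↦ (1 - t²)⁻¹ ∫ σ in t..1, f σ`. -/
def tailOp : C(unitInterval, ℝ) →L[ℝ] C(unitInterval, ℝ) :=
  kernelOp ⟨fun p => 1 / (1 + (p.1 : ℝ)), by
      refine continuous_const.div (by fun_prop) fun p => ?_
      have := p.1.2.1; positivity⟩
    ⟨fun p => p.1 + (1 - p.1) * p.2, by fun_prop⟩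

/-- The operator `f ↦ t⁻² ∫ σ in 0..t, 2 σ f σ`. -/
def headOp : C(unitInterval, ℝ) →L[ℝ] C(unitInterval, ℝ) :=
  kernelOp ⟨fun p => 2 * p.2, by fun_prop⟩ ⟨fun p => p.1 * p.2, by fun_prop⟩

/-- The substitution `σ = t + (1 - t) u` absorbs the factor `1 - t`, so that `tailOp` stays regular
at `t = 1`. -/
theorem tailOp_apply (f : C(unitInterval, ℝ)) (t : unitInterval) :
    (1 - (t : ℝ) ^ 2) * tailOp f t = ∫ σ in (t : ℝ)..1, ext f σ := by
  have h0 : (1 + (t : ℝ)) ≠ 0 := by have := t.2.1; positivity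
  have h := intervalIntegral.mul_integral_comp_add_mul (a := 0) (b := 1) (f := ext f)
    (1 - (t : ℝ)) t
  rw [show (t : ℝ) + (1 - t) * 0 = t by ring, show (t : ℝ) + (1 - t) * 1 = 1 by ring] at h
  rw [← h]
  simp only [tailOp, kernelOp_apply, ContinuousMap.coe_mk, intervalIntegral.integral_const_mul]
  field_simp
  ring

theorem tailOp_apply_one (f : C(unitInterval, ℝ)) : tailOp f 1 = f 1 / 2 := by
  have := ext_coe f 1
  simp only [Set.Icc.coe_one] at this
  simp [tailOp, kernelOp_apply, this]
  ring

theorem headOp_apply (f : C(unitInterval, ℝ)) (t : unitInterval) :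
    (t : ℝ) ^ 2 * headOp f t = ∫ σ in (0 : ℝ)..t, 2 * σ * ext f σ := by
  have h := intervalIntegral.mul_integral_comp_mul_left (a := 0) (b := 1)
    (f := fun σ => 2 * σ * ext f σ) (t : ℝ)
  rw [mul_zero, mul_one] at h
  rw [← h]
  simp only [headOp, kernelOp_apply, ContinuousMap.coe_mk]
  rw [pow_two, mul_assoc, ← intervalIntegral.integral_const_mul]
  congr 1
  exact intervalIntegral.integral_congr fun u _ => by ring

/-- The inclusion of `[0, 1]` into `ℝ`. -/
def coeI : C(unitInterval, ℝ) := ⟨Subtype.val, continuous_subtype_val⟩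

/-- The function `1 - t²` on `[0, 1]`. -/
def xI : C(unitInterval, ℝ) := 1 - coeI ^ 2

theorem xI_apply (t : unitInterval) : xI t = 1 - (t : ℝ) ^ 2 := rfl

namespace Params

/-- The map whose zeros `(φ, γ, ρ)` are the profiles of trajectories. -/
def profileMap (P : Params) (p : ℝ × C(unitInterval, ℝ) × C(unitInterval, ℝ) × ℝ) :
    C(unitInterval, ℝ) × C(unitInterval, ℝ) × ℝ :=
  (p.2.1 + p.1 • tailOp ((P.B₀ p.1 • 1 + (P.B₁ p.1 * p.2.2.2) • xI +
      (P.B₂ p.1 * p.2.2.2 ^ 2) • xI ^ 2) * p.2.2.1),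
    -- This is `γ_eq` divided by `τ² (1 - τ²)`, after `A₀` has been eliminated through the last
    -- component. That component is the solvability condition: the bracket in `γ_eq` must vanish at
    -- `τ = 0`.
    p.2.2.1 ^ 2 * ((P.A₁ p.1 * p.2.2.2 / 2) • 1 + (P.A₂ p.1 * p.2.2.2 ^ 2 / 3) • (1 + xI) +
      (tailOp ((2 : ℝ) • (coeI * p.2.1 ^ 2)) - headOp (p.2.1 ^ 2))) - 1,
    P.A₀ p.1 + ContinuousMap.evalCLM ℝ (1 : unitInterval) (headOp (p.2.1 ^ 2)) - P.A₁ p.1 * p.2.2.2 / 2 -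
      P.A₂ p.1 * p.2.2.2 ^ 2 / 3)

theorem contDiff_profileMap (P : Params) : ContDiff ℝ 1 P.profileMap := by
  have hΔ : ContDiff ℝ 1 P.Δ := by unfold Δ; fun_prop
  have hne := fun ε => (P.Δ_pos ε).ne'
  have a0 : ContDiff ℝ 1 P.A₀ := ContDiff.div (by fun_prop) hΔ hne
  have a1 : ContDiff ℝ 1 P.A₁ := ContDiff.div (by fun_prop) hΔ hne
  have a2 : ContDiff ℝ 1 P.A₂ := ContDiff.div (by fun_prop) hΔ hne
  have b0 : ContDiff ℝ 1 P.B₀ := ContDiff.div (by fun_prop) hΔ hne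
  have b1 : ContDiff ℝ 1 P.B₁ := ContDiff.div (by fun_prop) hΔ hne
  have b2 : ContDiff ℝ 1 P.B₂ := ContDiff.div (by fun_prop) hΔ hne
  unfold profileMap
  fun_prop

theorem isProfile_of_profileMap_eq_zero {P : Params} {ε ρ : ℝ} {φ γ : C(unitInterval, ℝ)}
    (hρ : 0 < ρ)
    (hγ : ∀ t, 0 < γ t) (h : P.profileMap (ε, φ, γ, ρ) = 0) :
    P.IsProfile ε ρ (ext φ) (ext γ) := by
  simp only [profileMap, Prod.mk_eq_zero] at h
  obtain ⟨h1, h2, h3⟩ := h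
  have h1' := fun t : unitInterval => DFunLike.congr_fun h1 t
  have h2' := fun t : unitInterval => DFunLike.congr_fun h2 t
  simp only [ContinuousMap.add_apply, ContinuousMap.smul_apply, ContinuousMap.zero_apply,
    ContinuousMap.mul_apply, ContinuousMap.sub_apply, ContinuousMap.pow_apply,
    ContinuousMap.one_apply, smul_eq_mul, xI_apply] at h1' h2'
  simp only [ContinuousMap.evalCLM_apply] at h3
  have tail : ∀ t : unitInterval, (1 - (t : ℝ) ^ 2) * tailOp ((2 : ℝ) • (coeI * φ ^ 2)) t =
      ∫ σ in (t : ℝ)..1, 2 * σ * ext φ σ ^ 2 := fun t => by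
    rw [tailOp_apply]
    refine intervalIntegral.integral_congr fun σ hσ => ?_
    rw [Set.uIcc_of_le t.2.2] at hσ
    have hσ' : σ ∈ Set.Icc (0 : ℝ) 1 := ⟨t.2.1.trans hσ.1, hσ.2⟩
    simp only [ext_of_mem _ hσ', ContinuousMap.smul_apply, ContinuousMap.mul_apply,
      ContinuousMap.pow_apply, smul_eq_mul, coeI, ContinuousMap.coe_mk]
    ring
  have head : ∀ t : unitInterval, (t : ℝ) ^ 2 * headOp (φ ^ 2) t =
      ∫ σ in (0 : ℝ)..t, 2 * σ * ext φ σ ^ 2 := fun t => by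
    rw [headOp_apply]
    refine intervalIntegral.integral_congr fun σ hσ => ?_
    rw [Set.uIcc_of_le t.2.1] at hσ
    have hσ' : σ ∈ Set.Icc (0 : ℝ) 1 := ⟨hσ.1, hσ.2.trans t.2.2⟩
    simp only [ext_of_mem _ hσ', ContinuousMap.pow_apply]
  have e1φ : ext φ 1 = φ 1 := ext_coe φ 1
  have e1γ : ext γ 1 = γ 1 := ext_coe γ 1
  refine ⟨hρ, continuous_ext φ, continuous_ext γ, ?_, fun τ hτ => ?_, fun τ hτ => ?_, ?_, ?_⟩
  · obtain ⟨t, -, ht⟩ := (isCompact_univ (X := unitInterval)).exists_isMinOn Set.univ_nonempty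
      γ.continuous.continuousOn
    exact ⟨γ t, hγ t, fun y => ht (Set.mem_univ _)⟩
  · have e := h1' ⟨τ, hτ⟩
    have e' := tailOp_apply ((P.B₀ ε • 1 + (P.B₁ ε * ρ) • xI + (P.B₂ ε * ρ ^ 2) • xI ^ 2) * γ)
      ⟨τ, hτ⟩
    have e'' : ∫ σ in τ..1, ext ((P.B₀ ε • 1 + (P.B₁ ε * ρ) • xI +
        (P.B₂ ε * ρ ^ 2) • xI ^ 2) * γ) σ = ∫ σ in τ..1,
        (P.B₀ ε + P.B₁ ε * (ρ * (1 - σ ^ 2)) + P.B₂ ε * (ρ * (1 - σ ^ 2)) ^ 2) * ext γ σ := by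
      refine intervalIntegral.integral_congr fun σ hσ => ?_
      rw [Set.uIcc_of_le hτ.2] at hσ
      have hσ' : σ ∈ Set.Icc (0 : ℝ) 1 := ⟨hτ.1.trans hσ.1, hσ.2⟩
      simp only [ext_of_mem _ hσ', ContinuousMap.smul_apply, ContinuousMap.mul_apply,
        ContinuousMap.pow_apply, ContinuousMap.add_apply, ContinuousMap.one_apply, smul_eq_mul,
        xI_apply]
      ring
    simp only at e e'
    rw [e''] at e'
    rw [← e', ext_of_mem _ hτ]
    linear_combination (1 - τ ^ 2) * e
  · have e := h2' ⟨τ, hτ⟩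
    have t1 := tail ⟨τ, hτ⟩
    have t2 := head ⟨τ, hτ⟩
    have t3 := head 1
    have hc : Continuous fun σ => 2 * σ * ext φ σ ^ 2 := by
      have := continuous_ext φ; fun_prop
    -- Splitting `∫₀¹ = ∫₀^τ + ∫_τ¹` yields `tail τ - head 1 = τ² (tail τ - head τ)`, the source of
    -- the factor `τ²`.
    have t4 := intervalIntegral.integral_add_adjacent_intervals
      (hc.intervalIntegrable (μ := volume) 0 τ) (hc.intervalIntegrable τ 1)
    simp only [Set.Icc.coe_one, one_pow, one_mul] at t1 t2 t3 e
    rw [← t2, ← t3, ← t1] at t4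
    rw [← t1, ext_of_mem _ hτ]
    linear_combination (-(1 - τ ^ 2) * τ ^ 2) * e + γ ⟨τ, hτ⟩ ^ 2 * (1 - τ ^ 2) * (-t4 - h3)
  · have e := h2' 1
    rw [tailOp_apply_one] at e
    simp only [Set.Icc.coe_one, ContinuousMap.smul_apply, ContinuousMap.mul_apply,
      ContinuousMap.pow_apply, smul_eq_mul, coeI, ContinuousMap.coe_mk] at e
    rw [e1φ, e1γ]
    linear_combination -e - γ 1 ^ 2 * h3
  · have e := h1' 1
    rw [tailOp_apply_one] at e
    simp only [Set.Icc.coe_one, ContinuousMap.smul_apply, ContinuousMap.mul_apply,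
      ContinuousMap.pow_apply, ContinuousMap.add_apply, ContinuousMap.one_apply, smul_eq_mul,
      xI_apply] at e
    rw [e1φ, e1γ]
    linear_combination 2 * e

end Params

end PCQNLS

/-! ### The unperturbed profile and the implicit function theorem. -/

namespace PCQNLS.Params

/-- `κ = √(1 - β)`. -/
def κ (P : Params) : ℝ := √(1 - P.β)

theorem κ_pos {P : Params} (hβ : P.β < 1) : 0 < P.κ := Real.sqrt_pos.2 (by linarith)

theorem κ_sq {P : Params} (hβ : P.β < 1) : P.κ ^ 2 = 1 + 16 / 3 * P.α * P.ω := by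
  rw [κ, Real.sq_sqrt (by linarith), β]; ring

/-- The value `R₀(0)²`. -/
def ρ₀ (P : Params) : ℝ := 4 * P.ω / (1 + P.κ)

theorem ρ₀_pos {P : Params} (hω : 0 < P.ω) (hβ : P.β < 1) : 0 < P.ρ₀ := by
  have := κ_pos hβ
  unfold ρ₀; positivity

theorem α_mul_ρ₀ {P : Params} (hβ : P.β < 1) : P.α * P.ρ₀ = 3 / 4 * (P.κ - 1) := by
  have := κ_pos hβ
  unfold ρ₀
  field_simp
  linear_combination -3 * κ_sq hβ

theorem ω_eq {P : Params} (hβ : P.β < 1) : P.ω = P.ρ₀ * (1 + P.κ) / 4 := by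
  have := κ_pos hβ
  unfold ρ₀
  field_simp

/-- The square of `1 / γ` for the unperturbed profile. -/
def η₀ (P : Params) : C(unitInterval, ℝ) :=
  (P.ρ₀ / 2) • 1 + (P.α * P.ρ₀ ^ 2 / 3) • (1 + xI)

/-- Eliminating `α` in favour of `κ` makes positivity on `[0, 1]` visible for either sign of `α`. -/
theorem η₀_apply {P : Params} (hβ : P.β < 1) (t : unitInterval) :
    P.η₀ t = P.ρ₀ / 4 * (P.κ * (2 - (t : ℝ) ^ 2) + (t : ℝ) ^ 2) := by
  simp only [η₀, ContinuousMap.add_apply, ContinuousMap.smul_apply, ContinuousMap.one_apply,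
    smul_eq_mul, xI_apply]
  linear_combination (P.ρ₀ / 3 * (2 - (t : ℝ) ^ 2)) * α_mul_ρ₀ hβ

theorem η₀_pos {P : Params} (hω : 0 < P.ω) (hβ : P.β < 1) (t : unitInterval) : 0 < P.η₀ t := by
  rw [η₀_apply hβ]
  have h1 := κ_pos hβ
  have h2 := ρ₀_pos hω hβ
  have h3 : (t : ℝ) ^ 2 ≤ 1 := pow_le_one₀ t.2.1 t.2.2
  have h4 : 0 < 2 - (t : ℝ) ^ 2 := by linarith
  positivity

open Classical in
/-- The function `γ` of the unperturbed profile. -/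
def γ₀ (P : Params) : C(unitInterval, ℝ) :=
  -- The condition holds whenever `ω > 0` and `β < 1`; the other branch is a dummy value.
  if h : ∀ t, 0 < P.η₀ t then
    ⟨fun t => 1 / √(P.η₀ t), continuous_const.div (by fun_prop)
      fun t => (Real.sqrt_pos.2 (h t)).ne'⟩
  else 0

theorem γ₀_apply {P : Params} (hω : 0 < P.ω) (hβ : P.β < 1) (t : unitInterval) :
    P.γ₀ t = 1 / √(P.η₀ t) := by
  rw [γ₀, dif_pos (η₀_pos hω hβ)]; rfl

theorem γ₀_pos {P : Params} (hω : 0 < P.ω) (hβ : P.β < 1) (t : unitInterval) : 0 < P.γ₀ t := by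
  rw [γ₀_apply hω hβ]
  have := Real.sqrt_pos.2 (η₀_pos hω hβ t)
  positivity

theorem γ₀_sq_mul_η₀ {P : Params} (hω : 0 < P.ω) (hβ : P.β < 1) : P.γ₀ ^ 2 * P.η₀ = 1 := by
  ext t
  have := η₀_pos hω hβ t
  simp only [ContinuousMap.mul_apply, ContinuousMap.pow_apply, γ₀_apply hω hβ,
    ContinuousMap.one_apply, div_pow, one_pow, Real.sq_sqrt this.le]
  field_simp

theorem coefficients_zero (P : Params) :
    P.A₀ 0 = P.ω ∧ P.A₁ 0 = 1 ∧ P.A₂ 0 = P.α := by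
  simp [A₀, A₁, A₂, Δ]

theorem profileMap_zero {P : Params} (hω : 0 < P.ω) (hβ : P.β < 1) :
    P.profileMap (0, 0, P.γ₀, P.ρ₀) = 0 := by
  obtain ⟨h0, h1, h2⟩ := P.coefficients_zero
  have e := γ₀_sq_mul_η₀ hω hβ
  rw [η₀] at e
  simp only [profileMap, h0, h1, h2, Prod.mk_eq_zero]
  refine ⟨by simp, ?_, ?_⟩
  · simp only [one_mul, ne_eq, OfNat.ofNat_ne_zero, not_false_eq_true,
      zero_pow, mul_zero, smul_zero, map_zero, add_zero, e, sub_self]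
  · simp only [ne_eq, OfNat.ofNat_ne_zero, not_false_eq_true, zero_pow, map_zero]
    linear_combination ω_eq hβ - P.ρ₀ / 3 * α_mul_ρ₀ hβ

/-- The partial derivative of `profileMap` at the unperturbed profile. -/
def profileDeriv (P : Params) :
    (C(unitInterval, ℝ) × C(unitInterval, ℝ) × ℝ) →L[ℝ] C(unitInterval, ℝ) ×
      C(unitInterval, ℝ) × ℝ :=
  (ContinuousLinearMap.fst ℝ _ _).prod
    (((ContinuousLinearMap.mul ℝ C(unitInterval, ℝ) ((2 : ℝ) • (P.γ₀ * P.η₀))).comp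
        ((ContinuousLinearMap.fst ℝ _ _).comp (ContinuousLinearMap.snd ℝ _ _)) +
      ((ContinuousLinearMap.snd ℝ _ _).comp (ContinuousLinearMap.snd ℝ _ _)).smulRight
        (P.γ₀ ^ 2 * ((1 / 2 : ℝ) • 1 + (2 * P.α * P.ρ₀ / 3) • (1 + xI)))).prod
    ((-(P.κ / 2)) • (ContinuousLinearMap.snd ℝ _ _).comp (ContinuousLinearMap.snd ℝ _ _)))

/-- The operator is triangular with diagonal entries `1`, multiplication by `2 γ₀ η₀`, and `-κ / 2`.
Since `γ₀² η₀ = 1`, the second is inverted by multiplication by `γ₀ / 2`. -/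
theorem profileDeriv_isInvertible {P : Params} (hω : 0 < P.ω) (hβ : P.β < 1) :
    P.profileDeriv.IsInvertible := by
  have hκ := (κ_pos hβ).ne'
  have e := γ₀_sq_mul_η₀ hω hβ
  set v : C(unitInterval, ℝ) :=
    P.γ₀ ^ 2 * ((1 / 2 : ℝ) • 1 + (2 * P.α * P.ρ₀ / 3) • (1 + xI)) with hv
  refine ContinuousLinearMap.IsInvertible.of_inverse
    (g := (ContinuousLinearMap.fst ℝ _ _).prod
      (((ContinuousLinearMap.mul ℝ C(unitInterval, ℝ) ((1 / 2 : ℝ) • P.γ₀)).comp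
        ((ContinuousLinearMap.fst ℝ _ _).comp (ContinuousLinearMap.snd ℝ _ _) +
          ((ContinuousLinearMap.snd ℝ _ _).comp (ContinuousLinearMap.snd ℝ _ _)).smulRight
            ((2 / P.κ) • v))).prod
      ((-(2 / P.κ)) • (ContinuousLinearMap.snd ℝ _ _).comp (ContinuousLinearMap.snd ℝ _ _)))) ?_ ?_
  · refine ContinuousLinearMap.ext fun p => ?_
    obtain ⟨a, b, c⟩ := p
    simp only [profileDeriv, ← hv, ContinuousLinearMap.comp_apply, ContinuousLinearMap.prod_apply,
      add_apply, ContinuousLinearMap.smulRight_apply,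
      ContinuousLinearMap.mul_apply', smul_apply, ContinuousLinearMap.coe_fst',
      ContinuousLinearMap.coe_snd', ContinuousLinearMap.id_apply, smul_eq_mul]
    refine Prod.ext rfl (Prod.ext ?_ ?_)
    · ext t
      have e' := DFunLike.congr_fun e t
      simp only [ContinuousMap.add_apply, ContinuousMap.mul_apply, ContinuousMap.smul_apply,
        smul_eq_mul, ContinuousMap.pow_apply, ContinuousMap.one_apply]
        at e' ⊢
      linear_combination (b t + c * (2 / P.κ * v t)) * e'
    · field_simp
  · refine ContinuousLinearMap.ext fun p => ?_
    obtain ⟨a, b, c⟩ := p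
    simp only [profileDeriv, ← hv, ContinuousLinearMap.comp_apply, ContinuousLinearMap.prod_apply,
      add_apply, ContinuousLinearMap.smulRight_apply,
      ContinuousLinearMap.mul_apply', smul_apply, ContinuousLinearMap.coe_fst',
      ContinuousLinearMap.coe_snd', ContinuousLinearMap.id_apply, smul_eq_mul]
    refine Prod.ext rfl (Prod.ext ?_ ?_)
    · ext t
      have e' := DFunLike.congr_fun e t
      simp only [ContinuousMap.add_apply, ContinuousMap.mul_apply, ContinuousMap.smul_apply,
        smul_eq_mul, ContinuousMap.pow_apply, ContinuousMap.one_apply]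
        at e' ⊢
      field_simp
      linear_combination 2 * b t * e'
    · field_simp

/-- At `ε = 0` the coupling terms in `φ` are quadratic and drop out at `φ = 0`. The entry `-1/2 -
2αρ₀/3` equals `-κ/2` by `α_mul_ρ₀`. -/
theorem hasFDerivAt_profileMap_zero {P : Params} (hβ : P.β < 1) :
    HasFDerivAt (fun u => P.profileMap (0, u)) P.profileDeriv (0, P.γ₀, P.ρ₀) := by
  obtain ⟨h0, h1, h2⟩ := P.coefficients_zero
  set u₀ : C(unitInterval, ℝ) × C(unitInterval, ℝ) × ℝ := (0, P.γ₀, P.ρ₀)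
  have dφ : HasFDerivAt (fun u : C(unitInterval, ℝ) × C(unitInterval, ℝ) × ℝ => u.1) _ u₀ :=
    hasFDerivAt_fst (𝕜 := ℝ)
  have dγ : HasFDerivAt (fun u : C(unitInterval, ℝ) × C(unitInterval, ℝ) × ℝ => u.2.1) _ u₀ :=
    (hasFDerivAt_fst (𝕜 := ℝ)).comp u₀ (hasFDerivAt_snd (𝕜 := ℝ))
  have dρ : HasFDerivAt (fun u : C(unitInterval, ℝ) × C(unitInterval, ℝ) × ℝ => u.2.2) _ u₀ :=
    (hasFDerivAt_snd (𝕜 := ℝ)).comp u₀ (hasFDerivAt_snd (𝕜 := ℝ))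
  have dφ2 := HasFDerivAt.pow dφ 2
  have dA := ((dρ.mul_const (1 / 2)).smul_const (1 : C(unitInterval, ℝ))).fun_add
    (((HasFDerivAt.pow dρ 2).const_mul (P.α / 3)).smul_const (1 + xI))
  have dK := ((tailOp.hasFDerivAt.comp u₀ ((dφ2.const_mul coeI).const_smul (2 : ℝ))).fun_sub
    (headOp.hasFDerivAt.comp u₀ dφ2))
  have d2 := ((HasFDerivAt.pow dγ 2).mul (dA.fun_add dK)).sub_const 1
  have d3 := ((((ContinuousMap.evalCLM ℝ (1 : unitInterval)).hasFDerivAt.comp u₀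
    (headOp.hasFDerivAt.comp u₀ dφ2)).const_add P.ω).fun_sub (dρ.mul_const (1 / 2))).fun_sub
      ((HasFDerivAt.pow dρ 2).const_mul (P.α / 3))
  have d := dφ.prodMk (d2.prodMk d3)
  refine (d.congr_of_eventuallyEq (Eventually.of_forall fun u => ?_)).congr_fderiv ?_
  · simp only [profileMap, h0, h1, h2, zero_smul, add_zero, one_mul, Function.comp,
      Pi.mul_apply, Pi.smul_apply]
    refine Prod.ext rfl (Prod.ext ?_ ?_)
    · simp only [div_eq_mul_inv, one_mul, mul_right_comm]
    · simp only; ring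
  · refine ContinuousLinearMap.ext fun p => ?_
    obtain ⟨a, b, c⟩ := p
    have hκ := α_mul_ρ₀ hβ
    refine Prod.ext ?_ (Prod.ext ?_ ?_)
    · simp [profileDeriv]
    · ext t
      have h2 : (2 : C(unitInterval, ℝ)) t = 2 := rfl
      simp [profileDeriv, u₀, η₀, h2]
      ring
    · simp [profileDeriv, u₀]
      linear_combination (-2 / 3 * c) * hκ

/-- For small `ε` there is a profile, and it depends differentiably on `ε` at `ε = 0`. -/
theorem exists_isProfile {P : Params} (hω : 0 < P.ω) (hβ : P.β < 1) :
    ∃ G : ℝ → ℝ, DifferentiableAt ℝ G 0 ∧ ∀ᶠ ε in 𝓝 0, ∃ ρ φ γ, P.IsProfile ε ρ φ γ ∧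
      G ε = ∫ σ in (0 : ℝ)..1,
        (P.B₀ ε + P.B₁ ε * (ρ * (1 - σ ^ 2)) + P.B₂ ε * (ρ * (1 - σ ^ 2)) ^ 2) * γ σ := by
  set u₀ : ℝ × C(unitInterval, ℝ) × C(unitInterval, ℝ) × ℝ := (0, 0, P.γ₀, P.ρ₀) with hu₀
  have hd : HasStrictFDerivAt P.profileMap (fderiv ℝ P.profileMap u₀) u₀ :=
    P.contDiff_profileMap.contDiffAt.hasStrictFDerivAt one_ne_zero
  have hinr : fderiv ℝ P.profileMap u₀ ∘L ContinuousLinearMap.inr ℝ ℝ _ = P.profileDeriv := by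
    have h1 : HasFDerivAt (fun u => P.profileMap (0, u))
        (fderiv ℝ P.profileMap u₀ ∘L ContinuousLinearMap.inr ℝ ℝ _) (0, P.γ₀, P.ρ₀) :=
      hd.hasFDerivAt.comp (0, P.γ₀, P.ρ₀) (hasFDerivAt_prodMk_right _ _)
    exact h1.unique (hasFDerivAt_profileMap_zero hβ)
  have hinv : (fderiv ℝ P.profileMap u₀ ∘L ContinuousLinearMap.inr ℝ ℝ _).IsInvertible :=
    hinr ▸ profileDeriv_isInvertible hω hβ
  set ψ := hd.implicitFunctionOfProdDomain hinv
  have hψd : DifferentiableAt ℝ ψ 0 :=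
    (hd.hasStrictFDerivAt_implicitFunctionOfProdDomain hinv).hasFDerivAt.differentiableAt
  have hψt : Tendsto ψ (𝓝 0) (𝓝 (0, P.γ₀, P.ρ₀)) :=
    hd.tendsto_implicitFunctionOfProdDomain hinv
  have hψe : ∀ᶠ ε in 𝓝 0, P.profileMap (ε, ψ ε) = 0 := by
    have h := hd.eventually_apply_implicitFunctionOfProdDomain hinv
    filter_upwards [h] with ε hε
    exact hε.trans (profileMap_zero hω hβ)
  have hρt : Tendsto (fun ε => (ψ ε).2.2) (𝓝 0) (𝓝 P.ρ₀) :=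
    (continuous_snd.comp continuous_snd).continuousAt.tendsto.comp hψt
  have hγt : Tendsto (fun ε => (ψ ε).2.1) (𝓝 0) (𝓝 P.γ₀) :=
    (continuous_fst.comp continuous_snd).continuousAt.tendsto.comp hψt
  -- Uniform distance below the positive minimum of `γ₀` keeps the perturbed `γ` positive.
  obtain ⟨t₀, -, ht₀⟩ := (isCompact_univ (X := unitInterval)).exists_isMinOn Set.univ_nonempty
    P.γ₀.continuous.continuousOn
  have hγp : ∀ᶠ ε in 𝓝 0, ∀ t, 0 < (ψ ε).2.1 t := by
    filter_upwards [Metric.tendsto_nhds.1 hγt _ (γ₀_pos hω hβ t₀)] with ε hε t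
    have h1 := (ContinuousMap.dist_apply_le_dist (f := (ψ ε).2.1) (g := P.γ₀) t).trans_lt hε
    have h2 : P.γ₀ t₀ ≤ P.γ₀ t := ht₀ (Set.mem_univ t)
    rw [Real.dist_eq] at h1
    linarith [(abs_lt.1 h1).1]
  have hΔd : Differentiable ℝ P.Δ := by unfold Δ; fun_prop
  have hne := (P.Δ_pos 0).ne'
  have b0 : DifferentiableAt ℝ P.B₀ 0 := (differentiableAt_const _).fun_div (hΔd 0) hne
  have b1 : DifferentiableAt ℝ P.B₁ 0 := (differentiableAt_const _).fun_div (hΔd 0) hne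
  have b2 : DifferentiableAt ℝ P.B₂ 0 := (differentiableAt_const _).fun_div (hΔd 0) hne
  refine ⟨fun ε => ContinuousMap.evalCLM ℝ (0 : unitInterval) (tailOp ((P.B₀ ε • 1 +
    (P.B₁ ε * (ψ ε).2.2) • xI + (P.B₂ ε * (ψ ε).2.2 ^ 2) • xI ^ 2) * (ψ ε).2.1)), by fun_prop, ?_⟩
  filter_upwards [hψe, hγp, hρt.eventually (lt_mem_nhds (ρ₀_pos hω hβ))] with ε h1 h2 h3
  refine ⟨(ψ ε).2.2, ext (ψ ε).1, ext (ψ ε).2.1, isProfile_of_profileMap_eq_zero h3 h2 h1, ?_⟩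
  have e := tailOp_apply ((P.B₀ ε • 1 + (P.B₁ ε * (ψ ε).2.2) • xI +
    (P.B₂ ε * (ψ ε).2.2 ^ 2) • xI ^ 2) * (ψ ε).2.1) 0
  simp only [Set.Icc.coe_zero, ne_eq, OfNat.ofNat_ne_zero, not_false_eq_true, zero_pow, sub_zero,
    one_mul] at e
  rw [ContinuousMap.evalCLM_apply, e]
  refine intervalIntegral.integral_congr fun σ hσ => ?_
  rw [Set.uIcc_of_le zero_le_one] at hσ
  simp only [ext_of_mem _ hσ, ContinuousMap.smul_apply, ContinuousMap.mul_apply,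
    ContinuousMap.pow_apply, ContinuousMap.add_apply, ContinuousMap.one_apply, smul_eq_mul,
    xI_apply]
  ring

end PCQNLS.Params

/-! ### The explicit wave `R₀`, its integrals and the Melnikov integral. -/

theorem Real.one_add_sq_half_le_cosh (x : ℝ) : 1 + x ^ 2 / 2 ≤ Real.cosh x := by
  have h1 : Real.cosh x = 1 + 2 * Real.sinh (x / 2) ^ 2 := by
    have h2 := Real.cosh_two_mul (x / 2)
    rw [mul_div_cancel₀ x two_ne_zero, Real.cosh_sq] at h2
    rw [h2]; ring
  have h3 : (x / 2) ^ 2 ≤ Real.sinh (x / 2) ^ 2 := by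
    rcases le_total 0 (x / 2) with h | h
    · exact pow_le_pow_left₀ h (Real.self_le_sinh_iff.2 h) 2
    · have := Real.sinh_le_self_iff.2 h
      nlinarith
  rw [h1]
  linarith [h3, show (x / 2) ^ 2 = x ^ 2 / 4 by ring]

namespace PCQNLS.Params

variable {P : Params}

/-- The denominator of `R₀²`. -/
def N (P : Params) (z : ℝ) : ℝ := 1 + P.κ * Real.cosh (2 * √P.ω * z)

theorem N_pos (hβ : P.β < 1) (z : ℝ) : 0 < P.N z := by
  have := κ_pos hβ
  have := Real.cosh_pos (2 * √P.ω * z)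
  unfold N; positivity

theorem R₀_eq (P : Params) (z : ℝ) : P.R₀ z = √(4 * P.ω / P.N z) := rfl

theorem R₀_sq (hω : 0 < P.ω) (hβ : P.β < 1) (z : ℝ) : P.R₀ z ^ 2 = 4 * P.ω / P.N z := by
  have := N_pos hβ z
  rw [R₀_eq, Real.sq_sqrt (by positivity)]

theorem R₀_pos (hω : 0 < P.ω) (hβ : P.β < 1) (z : ℝ) : 0 < P.R₀ z := by
  have := N_pos hβ z
  rw [R₀_eq]; exact Real.sqrt_pos.2 (by positivity)

theorem R₀_neg (P : Params) (z : ℝ) : P.R₀ (-z) = P.R₀ z := by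
  simp [R₀_eq, N]

theorem R₀_abs (P : Params) (z : ℝ) : P.R₀ |z| = P.R₀ z := by
  rcases abs_choice z with h | h <;> rw [h]
  exact P.R₀_neg z

theorem hasDerivAt_N (P : Params) (z : ℝ) :
    HasDerivAt P.N (2 * √P.ω * P.κ * Real.sinh (2 * √P.ω * z)) z := by
  have := ((((hasDerivAt_id z).const_mul (2 * √P.ω)).cosh).const_mul P.κ).const_add 1
  simp only [id, mul_one] at this
  convert! this using 1
  ring

theorem hasDerivAt_R₀_explicit (hω : 0 < P.ω) (hβ : P.β < 1) (z : ℝ) :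
    HasDerivAt P.R₀ (P.R₀ z * (-(√P.ω * P.κ * Real.sinh (2 * √P.ω * z)) / P.N z)) z := by
  have hN := N_pos hβ z
  have hR := R₀_pos hω hβ z
  have h := (((hasDerivAt_const z (4 * P.ω)).fun_div (P.hasDerivAt_N z) hN.ne').sqrt
    (by positivity))
  convert! h using 1
  rw [← R₀_eq, eq_div_iff (by positivity)]
  have := R₀_sq hω hβ z
  linear_combination (2 * (-(√P.ω * P.κ * Real.sinh (2 * √P.ω * z)) / P.N z)) * this

theorem S₀_eq (hω : 0 < P.ω) (hβ : P.β < 1) (z : ℝ) :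
    P.S₀ z = -(√P.ω * P.κ * Real.sinh (2 * √P.ω * z)) / P.N z := by
  rw [S₀, (hasDerivAt_R₀_explicit hω hβ z).deriv, mul_div_cancel_left₀ _ (R₀_pos hω hβ z).ne']

theorem hasDerivAt_R₀ (hω : 0 < P.ω) (hβ : P.β < 1) (z : ℝ) :
    HasDerivAt P.R₀ (P.R₀ z * P.S₀ z) z := by
  rw [S₀_eq hω hβ]; exact hasDerivAt_R₀_explicit hω hβ z

/-- The energy law for `r² s²` at `ε = 0`, `φ = 0`, checked on the explicit formula. -/
theorem S₀_sq (hω : 0 < P.ω) (hβ : P.β < 1) (z : ℝ) :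
    P.S₀ z ^ 2 = P.ω - P.R₀ z ^ 2 / 2 - P.α * (P.R₀ z ^ 2) ^ 2 / 3 := by
  have hN := N_pos hβ z
  have h1 := Real.cosh_sq (2 * √P.ω * z)
  have h2 := Real.sq_sqrt hω.le
  have h3 := κ_sq hβ
  have h4 : P.κ * Real.cosh (2 * √P.ω * z) = P.N z - 1 := by unfold N; ring
  have h5 : P.κ ^ 2 * Real.sinh (2 * √P.ω * z) ^ 2 = (P.N z - 1) ^ 2 - P.κ ^ 2 := by
    rw [← h4]; linear_combination (-P.κ ^ 2) * h1
  have h6 : P.S₀ z ^ 2 = P.ω * ((P.N z - 1) ^ 2 - P.κ ^ 2) / P.N z ^ 2 := by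
    rw [S₀_eq hω hβ, div_pow, ← h5]
    congr 1
    linear_combination (P.κ ^ 2 * Real.sinh (2 * √P.ω * z) ^ 2) * h2
  rw [h6, R₀_sq hω hβ, h3]
  field_simp
  ring

theorem hasDerivAt_S₀ (hω : 0 < P.ω) (hβ : P.β < 1) (z : ℝ) :
    HasDerivAt P.S₀ (-P.S₀ z ^ 2 + (P.ω - P.R₀ z ^ 2 - P.α * (P.R₀ z ^ 2) ^ 2)) z := by
  have hN := N_pos hβ z
  have hs := (((hasDerivAt_id z).const_mul (2 * √P.ω)).sinh).const_mul (√P.ω * P.κ)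
  have h := hs.fun_neg.fun_div (P.hasDerivAt_N z) hN.ne'
  have hfun : P.S₀ = fun z => -(√P.ω * P.κ * Real.sinh (2 * √P.ω * z)) / P.N z :=
    funext (S₀_eq hω hβ)
  have e : -P.S₀ z ^ 2 + (P.ω - P.R₀ z ^ 2 - P.α * (P.R₀ z ^ 2) ^ 2) =
      2 * P.S₀ z ^ 2 - 2 * P.ω + P.R₀ z ^ 2 / 2 := by
    linear_combination (-3) * S₀_sq hω hβ z
  rw [e, R₀_sq hω hβ]
  simp only [S₀_eq hω hβ]
  rw [hfun]
  convert! h using 1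
  have h2 := Real.sq_sqrt hω.le
  have h4 : P.κ * Real.cosh (2 * √P.ω * z) = P.N z - 1 := by unfold N; ring
  simp only [id, mul_one]
  field_simp
  linear_combination (4 * P.N z * P.κ * Real.cosh (2 * √P.ω * z)) * h2 +
    (4 * P.N z * P.ω) * h4

theorem S₀_pos (hω : 0 < P.ω) (hβ : P.β < 1) {z : ℝ} (hz : z < 0) : 0 < P.S₀ z := by
  rw [S₀_eq hω hβ]
  have h1 := κ_pos hβ
  have h2 := Real.sqrt_pos.2 hω
  have h3 : Real.sinh (2 * √P.ω * z) < 0 :=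
    Real.sinh_neg_iff.2 (mul_neg_of_pos_of_neg (by positivity) hz)
  refine div_pos ?_ (N_pos hβ z)
  have := mul_pos (mul_pos h2 h1) (neg_pos.2 h3)
  linarith

theorem S₀_zero (hω : 0 < P.ω) (hβ : P.β < 1) : P.S₀ 0 = 0 := by
  rw [S₀_eq hω hβ]; simp

/-- Quadratic growth of `cosh` already gives an integrable majorant, so exponential decay is not
needed. -/
theorem R₀_sq_le (hω : 0 < P.ω) (hβ : P.β < 1) (z : ℝ) :
    P.R₀ z ^ 2 ≤ 4 * P.ω / P.κ * (1 + (√(2 * P.ω) * z) ^ 2)⁻¹ := by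
  have h1 := κ_pos hβ
  have h2 : P.κ * (1 + (√(2 * P.ω) * z) ^ 2) ≤ P.N z := by
    have := Real.one_add_sq_half_le_cosh (2 * √P.ω * z)
    have e : (2 * √P.ω * z) ^ 2 / 2 = (√(2 * P.ω) * z) ^ 2 := by
      rw [mul_pow, mul_pow, mul_pow, Real.sq_sqrt hω.le, Real.sq_sqrt (by positivity)]; ring
    rw [e] at this
    unfold N
    nlinarith
  rw [R₀_sq hω hβ, ← div_eq_mul_inv, div_div]
  exact div_le_div_of_nonneg_left (by positivity) (by positivity) h2

theorem continuous_R₀ (hω : 0 < P.ω) (hβ : P.β < 1) : Continuous P.R₀ :=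
  continuous_iff_continuousAt.2 fun z => (hasDerivAt_R₀ hω hβ z).continuousAt

theorem continuous_S₀ (hω : 0 < P.ω) (hβ : P.β < 1) : Continuous P.S₀ :=
  continuous_iff_continuousAt.2 fun z => (hasDerivAt_S₀ hω hβ z).continuousAt

theorem tendsto_R₀_atBot (hω : 0 < P.ω) (hβ : P.β < 1) : Tendsto P.R₀ atBot (𝓝 0) := by
  have h1 : Tendsto (fun z : ℝ => 1 + (√(2 * P.ω) * z) ^ 2) atBot atTop := by
    refine tendsto_atTop_add_const_left _ _ ?_
    exact (tendsto_pow_atTop two_ne_zero).comp (tendsto_abs_atBot_atTop.comp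
      (tendsto_id.const_mul_atBot (Real.sqrt_pos.2 (by positivity : 0 < 2 * P.ω)))) |>.congr
        fun z => sq_abs _
  have h2 : Tendsto (fun z => P.R₀ z ^ 2) atBot (𝓝 0) := by
    have h3 := (tendsto_inv_atTop_zero.comp h1).const_mul (4 * P.ω / P.κ)
    rw [mul_zero] at h3
    exact squeeze_zero (fun z => sq_nonneg _) (R₀_sq_le hω hβ) h3
  have h4 := h2.sqrt
  rw [Real.sqrt_zero] at h4
  exact h4.congr fun z => Real.sqrt_sq (R₀_pos hω hβ z).le

theorem tendsto_R₀_atTop (hω : 0 < P.ω) (hβ : P.β < 1) : Tendsto P.R₀ atTop (𝓝 0) :=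
  ((tendsto_R₀_atBot hω hβ).comp tendsto_neg_atTop_atBot).congr P.R₀_neg

theorem tendsto_S₀_atBot (hω : 0 < P.ω) (hβ : P.β < 1) : Tendsto P.S₀ atBot (𝓝 √P.ω) := by
  have h2 := (tendsto_R₀_atBot hω hβ).pow 2
  have h3 := ((((h2.div_const 2).const_sub P.ω).sub (((h2.pow 2).const_mul P.α).div_const 3))).sqrt
  simp only [ne_eq, OfNat.ofNat_ne_zero, not_false_eq_true, zero_pow, zero_div, sub_zero,
    mul_zero] at h3
  refine h3.congr' ?_
  filter_upwards [eventually_lt_atBot 0] with z hz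
  rw [← S₀_sq hω hβ, Real.sqrt_sq (S₀_pos hω hβ hz).le]

/-- The unperturbed trajectory. -/
theorem isUnstableTrajectory_zero (hω : 0 < P.ω) (hβ : P.β < 1) :
    P.IsUnstableTrajectory 0 0 P.R₀ P.S₀ fun _ => 0 := by
  obtain ⟨h0, h1, h2⟩ := P.coefficients_zero
  have hsqrt := Real.sq_sqrt hω.le
  refine ⟨⟨fun z _ => (hasDerivAt_R₀ hω hβ z).hasDerivWithinAt, fun z _ => ?_, fun z _ => ?_⟩,
    fun z _ => R₀_pos hω hβ z, ⟨√P.ω, 0, ⟨Real.sqrt_pos.2 hω, ?_, ?_⟩, tendsto_R₀_atBot hω hβ,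
      tendsto_S₀_atBot hω hβ, tendsto_const_nhds⟩, S₀_zero hω hβ, fun z => S₀_pos hω hβ⟩
  · have := (hasDerivAt_S₀ hω hβ z).hasDerivWithinAt (s := Set.Iic 0)
    rw [fs_zero_speed, h0, h1, h2]
    convert! this using 1
    ring
  · rw [fφ_zero_speed]
    convert! hasDerivWithinAt_const z _ (0 : ℝ) using 1
    ring
  · rw [fs_zero_speed, h0, hsqrt]; ring
  · rw [fφ_zero_speed]; ring

theorem integrable_R₀_sq (hω : 0 < P.ω) (hβ : P.β < 1) : Integrable fun z => P.R₀ z ^ 2 := by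
  have h1 : Integrable fun z => 4 * P.ω / P.κ * (1 + (√(2 * P.ω) * z) ^ 2)⁻¹ :=
    (integrable_inv_one_add_sq.comp_mul_left'
      (Real.sqrt_pos.2 (by positivity : 0 < 2 * P.ω)).ne').const_mul _
  refine h1.mono' ((continuous_R₀ hω hβ).pow 2).aestronglyMeasurable
    (Eventually.of_forall fun z => ?_)
  rw [Real.norm_of_nonneg (sq_nonneg _)]
  exact R₀_sq_le hω hβ z

theorem R₀_sq_le_const (hω : 0 < P.ω) (hβ : P.β < 1) (z : ℝ) :
    P.R₀ z ^ 2 ≤ 4 * P.ω / P.κ := by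
  have h1 := κ_pos hβ
  refine (R₀_sq_le hω hβ z).trans (mul_le_of_le_one_right (by positivity) ?_)
  exact inv_le_one_of_one_le₀ (by nlinarith [sq_nonneg (√(2 * P.ω) * z)])

theorem integrable_bounded_mul_R₀_sq (hω : 0 < P.ω) (hβ : P.β < 1) {f : ℝ → ℝ}
    (hf : Continuous f) {C : ℝ} (hC : ∀ z, |f z| ≤ C) : Integrable fun z => f z * P.R₀ z ^ 2 :=
  (integrable_R₀_sq hω hβ).bdd_mul hf.aestronglyMeasurable (Eventually.of_forall hC)

theorem integrable_R₀_pow_four (hω : 0 < P.ω) (hβ : P.β < 1) :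
    Integrable fun z => P.R₀ z ^ 4 := by
  have := integrable_bounded_mul_R₀_sq hω hβ ((continuous_R₀ hω hβ).pow 2)
    (C := 4 * P.ω / P.κ) fun z => by
      simpa [abs_of_nonneg (sq_nonneg (P.R₀ z))] using R₀_sq_le_const hω hβ z
  exact this.congr (Eventually.of_forall fun z => by simp only [Pi.pow_apply]; ring)

theorem integrable_R₀_pow_six (hω : 0 < P.ω) (hβ : P.β < 1) :
    Integrable fun z => P.R₀ z ^ 6 := by
  have := integrable_bounded_mul_R₀_sq hω hβ (((continuous_R₀ hω hβ).pow 2).pow 2)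
    (C := (4 * P.ω / P.κ) ^ 2) fun z => by
      simp only [Pi.pow_apply, abs_pow, sq_abs]
      exact pow_le_pow_left₀ (sq_nonneg _) (R₀_sq_le_const hω hβ z) 2
  exact this.congr (Eventually.of_forall fun z => by simp only [Pi.pow_apply]; ring)

theorem abs_S₀_le (hω : 0 < P.ω) (hβ : P.β < 1) (z : ℝ) : |P.S₀ z| ≤ √P.ω := by
  have h1 := κ_pos hβ
  have hN := N_pos hβ z
  rw [S₀_eq hω hβ, abs_div, abs_neg, abs_mul, abs_mul, abs_of_pos h1, abs_of_pos hN,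
    abs_of_nonneg (Real.sqrt_nonneg _), div_le_iff₀ hN, mul_assoc]
  refine mul_le_mul_of_nonneg_left ?_ (Real.sqrt_nonneg _)
  have h2 : |Real.sinh (2 * √P.ω * z)| ≤ Real.cosh (2 * √P.ω * z) :=
    abs_le_of_sq_le_sq (by rw [Real.cosh_sq (2 * √P.ω * z)]; linarith) (Real.cosh_pos _).le
  unfold N
  nlinarith

theorem deriv_R₀ (hω : 0 < P.ω) (hβ : P.β < 1) (z : ℝ) :
    deriv P.R₀ z = P.R₀ z * P.S₀ z := (hasDerivAt_R₀ hω hβ z).deriv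

theorem integrable_deriv_R₀_sq (hω : 0 < P.ω) (hβ : P.β < 1) :
    Integrable fun z => deriv P.R₀ z ^ 2 := by
  have := integrable_bounded_mul_R₀_sq hω hβ ((continuous_S₀ hω hβ).pow 2)
    (C := √P.ω ^ 2) fun z => by
      simp only [Pi.pow_apply, abs_pow]
      exact pow_le_pow_left₀ (abs_nonneg _) (abs_S₀_le hω hβ z) 2
  refine this.congr (Eventually.of_forall fun z => ?_)
  simp only [Pi.pow_apply, deriv_R₀ hω hβ]
  ring

theorem integral_polynomial_R₀ (hω : 0 < P.ω) (hβ : P.β < 1) (c₀ c₁ c₂ : ℝ) :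
    Integrable (fun z => c₀ * P.R₀ z ^ 2 + c₁ * P.R₀ z ^ 4 + c₂ * P.R₀ z ^ 6) ∧
      ∫ z, (c₀ * P.R₀ z ^ 2 + c₁ * P.R₀ z ^ 4 + c₂ * P.R₀ z ^ 6) =
        c₀ * P.Λ 2 + c₁ * P.Λ 4 + c₂ * P.Λ 6 := by
  have i2 := (integrable_R₀_sq hω hβ).const_mul c₀
  have i4 := (integrable_R₀_pow_four hω hβ).const_mul c₁
  have i6 := (integrable_R₀_pow_six hω hβ).const_mul c₂
  have i24 : Integrable fun z => c₀ * P.R₀ z ^ 2 + c₁ * P.R₀ z ^ 4 := i2.add i4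
  refine ⟨i24.add i6, ?_⟩
  rw [integral_add i24 i6, integral_add i2 i4, integral_const_mul, integral_const_mul,
    integral_const_mul]
  rfl

/-- The derivative of `R₀ R₀' = R₀² S₀` integrates to zero over the line; `R₀''` is replaced through
the profile equation. -/
theorem Λ₂'_eq (hω : 0 < P.ω) (hβ : P.β < 1) :
    P.Λ₂' = P.Λ 4 + P.α * P.Λ 6 - P.ω * P.Λ 2 := by
  have i2' := integrable_deriv_R₀_sq hω hβ
  obtain ⟨i, hi⟩ := integral_polynomial_R₀ hω hβ P.ω (-1) (-P.α)
  have hd : ∀ z, HasDerivAt (fun z => P.R₀ z ^ 2 * P.S₀ z)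
      (deriv P.R₀ z ^ 2 +
        (P.ω * P.R₀ z ^ 2 + (-1) * P.R₀ z ^ 4 + (-P.α) * P.R₀ z ^ 6)) z := by
    intro z
    have := ((hasDerivAt_R₀ hω hβ z).fun_pow 2).fun_mul (hasDerivAt_S₀ hω hβ z)
    convert! this using 1
    rw [deriv_R₀ hω hβ]
    push_cast
    ring
  have hlim : ∀ {l : Filter ℝ}, Tendsto P.R₀ l (𝓝 0) →
      Tendsto (fun z => P.R₀ z ^ 2 * P.S₀ z) l (𝓝 0) := by
    intro l hl
    have h2 : Tendsto (fun z => P.R₀ z ^ 2) l (𝓝 0) := by simpa using hl.pow 2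
    have h3 := h2.mul_const (√P.ω)
    rw [zero_mul] at h3
    refine squeeze_zero_norm (fun z => ?_) h3
    rw [norm_mul, Real.norm_of_nonneg (sq_nonneg _)]
    exact mul_le_mul_of_nonneg_left (abs_S₀_le hω hβ z) (sq_nonneg _)
  have h := integral_of_hasDerivAt_of_tendsto hd (i2'.add i)
    (hlim (tendsto_R₀_atBot hω hβ)) (hlim (tendsto_R₀_atTop hω hβ))
  rw [integral_add i2' i, hi] at h
  unfold Λ₂'
  linarith

/-- For an unperturbed profile, `∫ B γ` over `[0, 1]` is the Melnikov integral along `R₀`. -/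
theorem IsProfile.two_mul_integral_eq (hω : 0 < P.ω) (hβ : P.β < 1) {ρ : ℝ} {φ γ : ℝ → ℝ}
    (h : P.IsProfile 0 ρ φ γ) (c₀ c₁ c₂ : ℝ) :
    2 * P.R₀ 0 ^ 2 * ∫ σ in (0 : ℝ)..1,
      (c₀ + c₁ * (ρ * (1 - σ ^ 2)) + c₂ * (ρ * (1 - σ ^ 2)) ^ 2) * γ σ =
    c₀ * P.Λ 2 + c₁ * P.Λ 4 + c₂ * P.Λ 6 := by
  obtain ⟨hB, hBi⟩ := integral_polynomial_R₀ hω hβ c₀ c₁ c₂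
  obtain ⟨τ, hτc, hτ0, hτpos, hτ1, hτlim, hτd, htraj⟩ := h.exists_isUnstableTrajectory
  have hr := (htraj.eqOn (isUnstableTrajectory_zero hω hβ)).1
  have hx : ∀ z ≤ 0, ρ * (1 - τ z ^ 2) = P.R₀ z ^ 2 := by
    intro z hz
    have hp := htraj.r_pos z hz
    rw [← hr hz, Real.sq_sqrt (Real.sqrt_pos.1 hp).le]
  have hρ : P.R₀ 0 ^ 2 = ρ := by rw [← hx 0 le_rfl, hτ0]; ring
  set f : ℝ → ℝ := fun σ =>
    (c₀ + c₁ * (ρ * (1 - σ ^ 2)) + c₂ * (ρ * (1 - σ ^ 2)) ^ 2) * γ σ with hf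
  have hfc : Continuous f := by have := h.continuous_γ; fun_prop
  have hFc : Continuous fun t => ρ * ∫ σ in t..1, f σ :=
    continuous_iff_continuousAt.2 fun t =>
      ((hfc.hasDerivAt_integral_left t 1).const_mul ρ).continuousAt
  -- Change of variables `ρ γ dσ = -R₀² dz`, valid since by uniqueness the profile trajectory at `ε
  -- = 0` is the explicit wave.
  have hd : ∀ z < 0, HasDerivAt (fun z => ρ * ∫ σ in (τ z)..1, f σ)
      (c₀ * P.R₀ z ^ 2 + c₁ * P.R₀ z ^ 4 + c₂ * P.R₀ z ^ 6) z := by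
    intro z hz
    have := ((hfc.hasDerivAt_integral_left (τ z) 1).const_mul ρ).comp z (hτd z)
    convert! this using 1
    have hγ := (h.γ_pos (τ z)).ne'
    have e := hx z hz.le
    simp only [hf]
    rw [e]
    field_simp
    linear_combination (-(P.R₀ z ^ 4 * c₂ + P.R₀ z ^ 2 * c₁ + c₀)) * e
  have hhalf := integral_Iic_of_hasDerivAt_of_tendsto (a := 0)
    (f := fun z => ρ * ∫ σ in (τ z)..1, f σ) (hFc.comp hτc).continuousWithinAt hd hB.integrableOn
    ((hFc.tendsto 1).comp hτlim)
  simp only [hτ0, intervalIntegral.integral_same, mul_zero, sub_zero] at hhalf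
  have hwhole : ∫ z, (c₀ * P.R₀ z ^ 2 + c₁ * P.R₀ z ^ 4 + c₂ * P.R₀ z ^ 6) =
      2 * ∫ z in Set.Iic 0, (c₀ * P.R₀ z ^ 2 + c₁ * P.R₀ z ^ 4 + c₂ * P.R₀ z ^ 6) := by
    have h1 := integral_comp_abs
      (f := fun z => c₀ * P.R₀ z ^ 2 + c₁ * P.R₀ z ^ 4 + c₂ * P.R₀ z ^ 6)
    have h2 := integral_comp_neg_Iic (0 : ℝ)
      (fun z => c₀ * P.R₀ z ^ 2 + c₁ * P.R₀ z ^ 4 + c₂ * P.R₀ z ^ 6)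
    simp only [R₀_abs, R₀_neg, neg_zero] at h1 h2
    rw [h1, h2]
  rw [hρ, mul_assoc, ← hhalf, ← hwhole, hBi]

end PCQNLS.Params

end

theorem mainTheorem6 (P : PCQNLS.Params) (hω : 0 < P.ω) (hβ : P.β < 1) :
    -- the trajectory on the unstable manifold exists and is unique for small `ε`
    (∀ᶠ ε in 𝓝 (0 : ℝ), ∃ r s φ : ℝ → ℝ, P.IsUnstableTrajectory 0 ε r s φ ∧
      ∀ r' s' φ' : ℝ → ℝ, P.IsUnstableTrajectory 0 ε r' s' φ' →
        Set.EqOn r' r (Set.Iic 0) ∧ Set.EqOn s' s (Set.Iic 0) ∧ Set.EqOn φ' φ (Set.Iic 0)) ∧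
    -- the integrals converge
    (Integrable (fun z => P.R₀ z ^ 2) ∧ Integrable (fun z => P.R₀ z ^ 4) ∧
      Integrable (fun z => P.R₀ z ^ 6) ∧ Integrable (fun z => deriv P.R₀ z ^ 2)) ∧
    -- the expansion of its `φ`-component at `z = 0`
    ∀ ru su φu : ℝ → ℝ → ℝ,
      (∀ᶠ ε in 𝓝 (0 : ℝ), P.IsUnstableTrajectory 0 ε (ru ε) (su ε) (φu ε)) →
      (∀ z ≤ 0, ru 0 z = P.R₀ z ∧ su 0 z = P.S₀ z ∧ φu 0 z = 0) ∧
      DifferentiableAt ℝ (fun ε => φu ε 0) 0 ∧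
      (fun ε => φu ε 0 - ε * PCQNLS.phiEps φu 0) =O[𝓝 0] (fun ε => ε ^ 2) ∧
      2 * P.R₀ 0 ^ 2 * PCQNLS.phiEps φu 0 =
        P.Λ₂' * P.a - P.Λ 2 * P.b - P.Λ 4 * P.d₁ - P.Λ 6 * P.d₂ := by
  obtain ⟨G, hG, hprof⟩ := PCQNLS.Params.exists_isProfile hω hβ
  refine ⟨?_, ⟨PCQNLS.Params.integrable_R₀_sq hω hβ, PCQNLS.Params.integrable_R₀_pow_four hω hβ,
    PCQNLS.Params.integrable_R₀_pow_six hω hβ, PCQNLS.Params.integrable_deriv_R₀_sq hω hβ⟩, ?_⟩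
  · filter_upwards [hprof] with ε ⟨ρ, φ, γ, h, _⟩
    obtain ⟨τ, -, -, -, -, -, -, htraj⟩ := h.exists_isUnstableTrajectory
    exact ⟨_, _, _, htraj, fun r' s' φ' h' => h'.eqOn htraj⟩
  intro ru su φu hu
  -- By uniqueness the given family is the constructed one, and `φ_eq` at `τ = 0` reads `φ = -ε
  -- G(ε)`.
  have hφG : (fun ε => φu ε 0) =ᶠ[𝓝 0] fun ε => -ε * G ε := by
    filter_upwards [hprof, hu] with ε ⟨ρ, φ, γ, h, hGε⟩ hε
    obtain ⟨τ, -, hτ0, -, -, -, -, htraj⟩ := h.exists_isUnstableTrajectory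
    have e := (hε.eqOn htraj).2.2 (Set.mem_Iic.2 le_rfl)
    simp only [hτ0] at e
    rw [e, hGε, ← h.φ_eq 0 ⟨le_rfl, zero_le_one⟩]
    ring
  have hderiv : HasDerivAt (fun ε => φu ε 0) (-G 0) 0 := by
    have := ((hasDerivAt_id (0 : ℝ)).fun_neg.fun_mul hG.hasDerivAt)
    refine HasDerivAt.congr_of_eventuallyEq ?_ hφG
    simpa using this
  have hphi : PCQNLS.phiEps φu 0 = -G 0 := hderiv.deriv
  refine ⟨fun z hz => ?_, hderiv.differentiableAt, ?_, ?_⟩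
  · obtain ⟨h1, h2, h3⟩ := hu.self_of_nhds.eqOn (PCQNLS.Params.isUnstableTrajectory_zero hω hβ)
    exact ⟨h1 hz, h2 hz, h3 hz⟩
  · have h1 : (fun ε => -ε * (G ε - G 0)) =O[𝓝 0] fun ε : ℝ => ε * ε := by
      have := hG.isBigO_sub
      simp only [sub_zero] at this
      exact (isBigO_refl (fun ε : ℝ => ε) _).neg_left.mul this
    refine h1.congr' ?_ (Eventually.of_forall fun ε => (pow_two ε).symm)
    filter_upwards [hφG] with ε hε
    rw [hε, hphi]
    ring
  · obtain ⟨ρ, φ, γ, h, hG0⟩ := hprof.self_of_nhds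
    have e := h.two_mul_integral_eq hω hβ (P.B₀ 0) (P.B₁ 0) (P.B₂ 0)
    rw [← hG0] at e
    have hB : P.B₀ 0 = P.b + P.a * P.ω ∧ P.B₁ 0 = P.d₁ - P.a ∧ P.B₂ 0 = P.d₂ - P.a * P.α := by
      simp [PCQNLS.Params.B₀, PCQNLS.Params.B₁, PCQNLS.Params.B₂, PCQNLS.Params.Δ]
    rw [hB.1, hB.2.1, hB.2.2] at e
    rw [hphi]
    -- The `a`-terms of `B₀`, `B₁`, `B₂` combine to `a (ω Λ 2 - Λ 4 - α Λ 6) = -a Λ₂'`.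
    linear_combination -e - P.a * PCQNLS.Params.Λ₂'_eq hω hβ
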